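/- Let $0<\alpha\le 1$, $0<\beta<1$, $\lambda>0$, $\mu\ge 0$, $\nu\ge 0$, and assume $\mu<\lambda$ or $\alpha=1$. For $0<\gamma\le1$ and $\theta\ge0$, a tempered $\gamma$-stable subordinator $S_{\gamma,\theta}$ is a nondecreasing, right-continuous process with $S_{\gamma,\theta}(0)=0$ and with independent stationary increments, such that the law of $S_{\gamma,\theta}(t)$ has density $e^{-\theta x+\theta^{\gamma}t}$ with respect to the $\gamma$-stable law on $[0,\infty)$ with Laplace transform $s\mapsto e^{-ts^{\gamma}}$. Let $N$ be a homogeneous Poisson process with rate $\lambda$, let $S_{\alpha,\mu}$ and $S_{\beta,\nu}$ be tempered stable subordinators, the three processes being mutually independent, and let $Y_{\beta,\nu}(t)=\inf\{r>0: S_{\beta,\nu}(r)>t\}$. Then for all $k\in\{0,1,2,\dots\}$ and $t\ge 0$ the state probabilities $P^{\alpha,\mu}_{\beta,\nu}(k,t)=\mathbb P\big(N(S_{\alpha,\mu}(Y_{\beta,\nu}(t)))=k\big)$ of the tempered time-space-fractional Poisson process are given by $$P^{\alpha,\mu}_{\beta,\nu}(k,t)=(-1)^k e^{-\nu t}\sum_{m=0}^{\infty}t^m\nu^m\sum_{r=0}^{\infty}(-t^{\beta})^r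 M^{r}_{\beta,\beta r+m+1}(t^{\beta}\nu^{\beta})\sum_{h=0}^{r}\binom{r}{h}(-\mu^{\alpha})^{r-h}\sum_{l=0}^{\infty}\binom{\alpha h}{l}\binom{\alpha h-l}{k}\mu^{l}\lambda^{\alpha h-l},$$ where each of the infinite series (in $l$, in $r$, in $m$, and the series defining $M$) converges absolutely. Here $\binom{a}{j}=\frac{a(a-1)\cdots(a-j+1)}{j!}$ is the generalized binomial coefficient, $M^{c}_{a,b}(z)=\sum_{n=0}^{\infty}\frac{(c)_n}{\Gamma(an+b)}\frac{z^n}{n!}$ is the Prabhakar function with $(c)_n=c(c+1)\cdots(c+n-1)$, $(c)_0=1$, and $0^0=1$. -/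

import Mathlib

open MeasureTheory ProbabilityTheory
open scoped NNReal ENNReal Nat

namespace TemperedPoisson

/-- `N` is a homogeneous Poisson process with rate `lam`: it starts at `0`, its paths are
nondecreasing and right-continuous, its increments are independent, and the increment over
`[s, t]` has the Poisson law with parameter `lam * (t - s)`. Subtraction in `ℕ` and `ℝ≥0` is only
used between ordered quantities, so that no truncation takes place. -/
structure IsPoissonProcess {Ω : Type*} [MeasurableSpace Ω] (lam : ℝ≥0)
    (N : ℝ≥0 → Ω → ℕ) (P : Measure Ω) : Prop where
  measurable : ∀ t, Measurable (N t)
  paths : ∀ᵐ ω ∂P, N 0 ω = 0 ∧ Monotone (fun t => N t ω) ∧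
    ∀ t, ContinuousWithinAt (fun s => N s ω) (Set.Ici t) t
  indep : HasIndepIncrements N P
  law : ∀ s t : ℝ≥0, s ≤ t → P.map (fun ω => N t ω - N s ω) = poissonMeasure (lam * (t - s))

/-- `m` is the law on `[0, ∞)` of the `α`-stable subordinator at time `t`, that is, the probability
measure with Laplace transform `exp (-t s ^ α)`. For `α = 1` it is the point mass at `t`. -/
def IsStableLaw (α t : ℝ) (m : Measure ℝ≥0) : Prop :=
  IsProbabilityMeasure m ∧
    ∀ s : ℝ, 0 ≤ s → ∫ x, Real.exp (-s * x) ∂m = Real.exp (-t * s ^ α)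

/-- `m` is the law of the tempered `α`-stable subordinator with tempering parameter `μ` at
time `t`: it has density `exp (-μ x + μ ^ α t)` with respect to the `α`-stable law at time `t`. -/
def IsTemperedStableLaw (α μ t : ℝ) (m : Measure ℝ≥0) : Prop :=
  ∃ m₀ : Measure ℝ≥0, IsStableLaw α t m₀ ∧
    m = m₀.withDensity (fun x => ENNReal.ofReal (Real.exp (-μ * x + μ ^ α * t)))

/-- `S` is a tempered `α`-stable subordinator with tempering parameter `μ`: it starts at `0`, its
paths are nondecreasing and right-continuous, its increments are independent, and the increment
over `[s, t]` has the tempered stable law at time `t - s`. -/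
structure IsTemperedStableSubordinator {Ω : Type*} [MeasurableSpace Ω] (α μ : ℝ)
    (S : ℝ≥0 → Ω → ℝ≥0) (P : Measure Ω) : Prop where
  measurable : ∀ t, Measurable (S t)
  paths : ∀ᵐ ω ∂P, S 0 ω = 0 ∧ Monotone (fun t => S t ω) ∧
    ∀ t, ContinuousWithinAt (fun s => S s ω) (Set.Ici t) t
  indep : HasIndepIncrements S P
  law : ∀ s t : ℝ≥0, s ≤ t →
    IsTemperedStableLaw α μ ((t : ℝ) - s) (P.map (fun ω => S t ω - S s ω))

/-- The right-continuous inverse `t ↦ inf {r > 0 : D r > t}` of a process `D`. -/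
noncomputable def inverseProcess {Ω : Type*} (D : ℝ≥0 → Ω → ℝ≥0) (t : ℝ≥0) (ω : Ω) : ℝ≥0 :=
  sInf {r : ℝ≥0 | 0 < r ∧ t < D r ω}

/-- The `n`-th term `(c)_n / Γ(a n + b) * z ^ n / n!` of the Prabhakar series. -/
noncomputable def prabhakarTerm (a b c z : ℝ) (n : ℕ) : ℝ :=
  (ascPochhammer ℝ n).eval c / Real.Gamma (a * n + b) * (z ^ n / n !)

/-- The Prabhakar (generalized Mittag-Leffler) function `M_{a,b}^c(z)`, for real arguments. -/
noncomputable def prabhakar (a b c z : ℝ) : ℝ :=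
  ∑' n : ℕ, prabhakarTerm a b c z n

/-- `binom(αh, l) binom(αh - l, k) μ ^ l lam ^ (αh - l)`, with generalized binomial
coefficients. -/
noncomputable def binomTerm (α μ lam : ℝ) (k h l : ℕ) : ℝ :=
  Ring.choose (α * h) l * Ring.choose (α * h - l) k * μ ^ l * lam ^ (α * h - l)

/-- The term with index `(m, r)` of the series for the state probabilities, without the
prefactor `(-1) ^ k * exp (-ν t)`. -/
noncomputable def stateTerm (α μ β ν lam t : ℝ) (k m r : ℕ) : ℝ :=
  (-(t ^ β)) ^ r * prabhakar β (β * r + m + 1) r (t ^ β * ν ^ β) *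
    ∑ h ∈ Finset.range (r + 1), (r.choose h : ℝ) * (-(μ ^ α)) ^ (r - h) *
      ∑' l : ℕ, binomTerm α μ lam k h l

end TemperedPoisson

open TemperedPoisson

/-! Write φ(s) = (s+ν)^β - ν^β for the Laplace exponent of D, Y for the first passage time of D
above t, and ψ(u) = (λ(1-u)+μ)^α - μ^α. Conditioning first on S(Y) and then on Y gives the
generating function E u^{N(S(Y))} = E exp(-Y ψ(u)) for |u| < 1 (`hasSum_stateProbability`).
Expanding the exponential in the normalized moments e_n = E Y^n/n!, expanding ψ(u)^n in powers of u,
and comparing coefficients of u^k expresses the state probability as ∑ (-1)^n e_n [u^k]ψ(u)^n.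

The moments come from potential measures. By the layer-cake formula, e_{p+1} is the mass of (-∞, t]
under ∫ r^p/p! ℙ(D_r ∈ ·) dr, whose Laplace transform is φ(s)^{-(p+1)}. A negative binomial
expansion in ν^β(s+ν)^{-β} inverts this transform (`potential_eq`), and integrating the density over
(0, t] by Beta integrals produces the Prabhakar functions and the sum over m (`potential_Iic`).

Convergence rests on two bounds. The coefficients of ψ^n grow at most geometrically in n
(`abs_exponentCoeff_le`), whereas e_n ≤ e^{st} φ(s)^{-n} for every s > 0 with φ unbounded, so that ∑
K^n e_n < ∞ for all K ≥ 0 (`summable_pow_mul_integral_pow`). Hence the double series in m and r is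
absolutely summable and can be rearranged. -/

namespace TemperedPoisson

open Set Filter Topology

/-! ### Uniqueness of Laplace transforms, and Gamma and Beta integrals. -/

section Laplace

/-- The complex moment generating functions are analytic on Re z < 1. Agreement at real points
accumulating at 0 spreads by the identity theorem to the imaginary axis, where they are the
characteristic functions. -/
theorem measure_ext_of_mgf_eq_of_lt_one {μ ν : Measure ℝ} [IsFiniteMeasure μ] [IsFiniteMeasure ν]
    (hμ : ∀ s < 1, Integrable (fun x => Real.exp (s * x)) μ)
    (hν : ∀ s < 1, Integrable (fun x => Real.exp (s * x)) ν)
    (h : ∀ s < 1, mgf id μ s = mgf id ν s) : μ = ν := by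
  have aux : ∀ {ρ : Measure ℝ}, (∀ s < 1, Integrable (fun x => Real.exp (s * x)) ρ) →
      AnalyticOnNhd ℂ (complexMGF id ρ) {z | z.re < 1} := by
    intro ρ hρ z hz
    refine analyticOnNhd_complexMGF z ?_
    have : Iio (1 : ℝ) ⊆ integrableExpSet id ρ := fun s hs => hρ s hs
    exact interior_maximal this isOpen_Iio hz
  have hpre : IsPreconnected {z : ℂ | z.re < 1} := (convex_halfSpace_re_lt 1).isPreconnected
  have hEq := AnalyticOnNhd.eqOn_of_preconnected_of_frequently_eq (aux hμ) (aux hν) hpre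
    (z₀ := 0) (by simp) (by
      have h_real : ∃ᶠ x : ℝ in 𝓝[≠] 0, complexMGF id μ x = complexMGF id ν x := by
        refine Eventually.frequently ?_
        have : ∀ᶠ x : ℝ in 𝓝[≠] 0, x < 1 :=
          nhdsWithin_le_nhds (Iio_mem_nhds one_pos)
        filter_upwards [this] with x hx
        rw [complexMGF_ofReal, complexMGF_ofReal, h x hx]
      rw [frequently_iff_seq_forall] at h_real ⊢
      obtain ⟨xs, hx_tendsto, hx_eq⟩ := h_real
      refine ⟨fun n ↦ xs n, ?_, fun n ↦ hx_eq n⟩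
      rw [tendsto_nhdsWithin_iff] at hx_tendsto ⊢
      refine ⟨?_, by simpa using hx_tendsto.2⟩
      have := (Complex.continuous_ofReal.tendsto 0).comp hx_tendsto.1
      simpa [Function.comp_def] using this)
  refine Measure.ext_of_charFun (funext fun s => ?_)
  have := hEq (x := (s : ℂ) * Complex.I) (by simp)
  rw [← complexMGF_id_mul_I, ← complexMGF_id_mul_I]
  exact this

/-- Potential measures may be infinite. Weighting by e^{-x} makes both measures finite and turns the
mgf at s into the Laplace transform at 1 - s; the weight is strictly positive and can be divided out
afterwards. -/
theorem measure_ext_of_laplace_eq {U W : Measure ℝ}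
    (hU : ∀ s : ℝ, 0 < s → ∫⁻ x, ENNReal.ofReal (Real.exp (-s * x)) ∂U ≠ ∞)
    (h : ∀ s : ℝ, 0 < s → ∫⁻ x, ENNReal.ofReal (Real.exp (-s * x)) ∂U =
      ∫⁻ x, ENNReal.ofReal (Real.exp (-s * x)) ∂W) : U = W := by
  have hm : ∀ s : ℝ, Measurable fun x : ℝ => ENNReal.ofReal (Real.exp (s * x)) := fun s => by
    fun_prop
  have key : ∀ (s : ℝ) (V : Measure ℝ),
      ∫⁻ x, ENNReal.ofReal (Real.exp (s * x)) ∂(V.withDensity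
        fun x => ENNReal.ofReal (Real.exp (-1 * x))) =
      ∫⁻ x, ENNReal.ofReal (Real.exp (-(1 - s) * x)) ∂V := by
    intro s V
    rw [lintegral_withDensity_eq_lintegral_mul _ (hm (-1)) (hm s)]
    refine lintegral_congr fun x => ?_
    rw [Pi.mul_apply, ← ENNReal.ofReal_mul (Real.exp_pos _).le, ← Real.exp_add]
    ring_nf
  have hW : ∀ s : ℝ, 0 < s → ∫⁻ x, ENNReal.ofReal (Real.exp (-s * x)) ∂W ≠ ∞ :=
    fun s hs => h s hs ▸ hU s hs
  have hfin : ∀ V : Measure ℝ, ∫⁻ x, ENNReal.ofReal (Real.exp (-1 * x)) ∂V ≠ ∞ →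
      IsFiniteMeasure (V.withDensity fun x => ENNReal.ofReal (Real.exp (-1 * x))) :=
    fun V hV => isFiniteMeasure_withDensity hV
  have hint : ∀ V : Measure ℝ, (∀ s : ℝ, 0 < s →
      ∫⁻ x, ENNReal.ofReal (Real.exp (-s * x)) ∂V ≠ ∞) → ∀ s < 1,
      Integrable (fun x => Real.exp (s * x))
        (V.withDensity fun x => ENNReal.ofReal (Real.exp (-1 * x))) := by
    intro V hV s hs
    refine ⟨by fun_prop, ?_⟩
    rw [hasFiniteIntegral_iff_ofReal (ae_of_all _ fun x => (Real.exp_pos _).le), key]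
    exact (hV _ (by linarith)).lt_top
  have := hfin U (hU 1 one_pos)
  have := hfin W (hW 1 one_pos)
  have heq := measure_ext_of_mgf_eq_of_lt_one (hint U hU) (hint W hW) (by
    intro s hs
    simp only [mgf, id]
    rw [integral_eq_lintegral_of_nonneg_ae (ae_of_all _ fun x => (Real.exp_pos _).le)
      (by fun_prop), integral_eq_lintegral_of_nonneg_ae
      (ae_of_all _ fun x => (Real.exp_pos _).le) (by fun_prop), key, key, h _ (by linarith)])
  have hinv : ∀ V : Measure ℝ, (V.withDensity fun x => ENNReal.ofReal (Real.exp (-1 * x))).withDensity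
      (fun x => (ENNReal.ofReal (Real.exp (-1 * x)))⁻¹) = V := fun V =>
    withDensity_inv_same (hm (-1)) (ae_of_all _ fun x => by simp [Real.exp_pos])
      (ae_of_all _ fun x => ENNReal.ofReal_ne_top)
  rw [← hinv U, heq, hinv W]

/-- This is B(a, m+1) rescaled to (0, t], taken from the complex Beta integral and pulled back along
the cast ℝ → ℂ. -/
theorem lintegral_Ioc_sub_pow_mul_rpow {a t : ℝ} (ha : 0 < a) (ht : 0 < t) (m : ℕ) :
    ∫⁻ x in Ioc 0 t, ENNReal.ofReal ((t - x) ^ m * x ^ (a - 1)) =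
      ENNReal.ofReal (m ! * Real.Gamma a * t ^ (a + m) / Real.Gamma (a + m + 1)) := by
  have hint : IntervalIntegrable (fun x : ℝ => (t - x) ^ m * x ^ (a - 1)) volume 0 t :=
    (intervalIntegral.intervalIntegrable_rpow' (by linarith)).continuousOn_mul
      (by fun_prop)
  have hC := Complex.betaIntegral_scaled (a : ℂ) ((m : ℂ) + 1) ht
  have hG := Complex.Gamma_mul_Gamma_eq_betaIntegral (s := (a : ℂ)) (t := (m : ℂ) + 1)
    (by simpa using ha) (by simp; positivity)
  have hR : ∫ x in (0 : ℝ)..t, (t - x) ^ m * x ^ (a - 1) =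
      m ! * Real.Gamma a * t ^ (a + m) / Real.Gamma (a + m + 1) := by
    have hpos : 0 < Real.Gamma (a + m + 1) := Real.Gamma_pos_of_pos (by positivity)
    rw [eq_div_iff hpos.ne', ← Complex.ofReal_inj]
    push_cast [← intervalIntegral.integral_ofReal]
    rw [Complex.ofReal_cpow ht.le, ← Complex.Gamma_ofReal, ← Complex.Gamma_ofReal]
    rw [Complex.Gamma_nat_eq_factorial] at hG
    have : (∫ x in (0 : ℝ)..t, ((t : ℂ) - x) ^ m * ((x ^ (a - 1) : ℝ) : ℂ)) =
        ∫ x in (0 : ℝ)..t, (x : ℂ) ^ ((a : ℂ) - 1) * ((t : ℂ) - x) ^ ((m : ℂ) + 1 - 1) := by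
      refine intervalIntegral.integral_congr fun x hx => ?_
      rw [uIcc_of_le ht.le] at hx
      simp only [add_sub_cancel_right, Complex.cpow_natCast]
      rw [Complex.ofReal_cpow hx.1, mul_comm]
      push_cast
      rfl
    rw [this, hC]
    have e1 : (a : ℂ) + (m + 1) - 1 = a + m := by ring
    rw [e1]
    push_cast
    rw [add_assoc, mul_assoc, mul_comm (Complex.betaIntegral _ _), ← hG]
    ring
  rw [← hR, intervalIntegral.integral_of_le ht.le, ofReal_integral_eq_lintegral_ofReal]
  · exact (intervalIntegrable_iff_integrableOn_Ioc_of_le ht.le).1 hint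
  · refine (ae_restrict_iff' measurableSet_Ioc).2 (ae_of_all _ fun x hx => ?_)
    have := hx.1
    have := sub_nonneg.2 hx.2
    simp only [Pi.zero_apply]; positivity

/-- Write e^{-νx} = e^{-νt} e^{ν(t-x)} and expand only the second factor: every term is then
nonnegative and gives a Beta integral. This is the source of the prefactor e^{-νt} and of the sum
over m. -/
theorem lintegral_Ioc_exp_mul_rpow {a t ν : ℝ} (ha : 0 < a) (ht : 0 ≤ t) (hν : 0 ≤ ν) :
    ∫⁻ x in Ioc 0 t, ENNReal.ofReal (Real.exp (-ν * x) * x ^ (a - 1) / Real.Gamma a) =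
      ∑' m : ℕ, ENNReal.ofReal
        (Real.exp (-(t * ν)) * ν ^ m * t ^ (a + m) / Real.Gamma (a + m + 1)) := by
  have hΓ : 0 < Real.Gamma a := Real.Gamma_pos_of_pos ha
  rcases ht.eq_or_lt with rfl | ht
  · have : ∀ m : ℕ, (0 : ℝ) ^ (a + m) = 0 := fun m => Real.zero_rpow (by positivity)
    simp [this]
  have hexp : ∀ x ∈ Ioc 0 t,
      ENNReal.ofReal (Real.exp (-ν * x) * x ^ (a - 1) / Real.Gamma a) =
      ∑' m : ℕ, ENNReal.ofReal (Real.exp (-(t * ν)) * ν ^ m / (m ! * Real.Gamma a)) *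
        ENNReal.ofReal ((t - x) ^ m * x ^ (a - 1)) := by
    intro x hx
    have h0 := sub_nonneg.2 hx.2
    have hx0 := hx.1
    have hs : HasSum (fun m : ℕ => Real.exp (-(t * ν)) * ν ^ m / (m ! * Real.Gamma a) *
        ((t - x) ^ m * x ^ (a - 1))) (Real.exp (-ν * x) * x ^ (a - 1) / Real.Gamma a) := by
      have h1 : HasSum (fun m : ℕ => (ν * (t - x)) ^ m / m !) (Real.exp (ν * (t - x))) := by
        have := NormedSpace.expSeries_div_hasSum_exp (𝔸 := ℝ) (ν * (t - x))
        rwa [← Real.exp_eq_exp_ℝ] at this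
      have h2 := h1.mul_left (Real.exp (-(t * ν)) * x ^ (a - 1) / Real.Gamma a)
      have e : Real.exp (-ν * x) = Real.exp (-(t * ν)) * Real.exp (ν * (t - x)) := by
        rw [← Real.exp_add]; ring_nf
      have e2 : Real.exp (-ν * x) * x ^ (a - 1) / Real.Gamma a =
          Real.exp (-(t * ν)) * x ^ (a - 1) / Real.Gamma a * Real.exp (ν * (t - x)) := by
        rw [e]; ring
      rw [e2]
      refine h2.congr_fun fun m => ?_
      rw [mul_pow]; field_simp
    rw [← hs.tsum_eq, ENNReal.ofReal_tsum_of_nonneg (fun m => by positivity) hs.summable]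
    refine tsum_congr fun m => ?_
    rw [ENNReal.ofReal_mul (by positivity)]
  rw [setLIntegral_congr_fun measurableSet_Ioc hexp, lintegral_tsum (fun m => by fun_prop)]
  refine tsum_congr fun m => ?_
  rw [lintegral_const_mul _ (by fun_prop), lintegral_Ioc_sub_pow_mul_rpow ha ht,
    ← ENNReal.ofReal_mul (by positivity)]
  congr 1
  field_simp

theorem lintegral_Ioi_exp_mul_rpow {a s : ℝ} (ha : 0 < a) (hs : 0 < s) :
    ∫⁻ x in Ioi 0, ENNReal.ofReal (Real.exp (-s * x) * x ^ (a - 1) / Real.Gamma a) =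
      ENNReal.ofReal (s ^ (-a)) := by
  have hΓ : 0 < Real.Gamma a := Real.Gamma_pos_of_pos ha
  have h := Real.integral_rpow_mul_exp_neg_mul_Ioi ha hs
  -- Integrability is free: a non-integrable function has integral 0 by convention, and this
  -- integral is positive.
  have hne : ∫ x in Ioi (0 : ℝ), x ^ (a - 1) * Real.exp (-(s * x)) ≠ 0 := by
    rw [h]; positivity
  have hi : Integrable (fun x : ℝ => x ^ (a - 1) * Real.exp (-(s * x)))
      (volume.restrict (Ioi 0)) := not_imp_comm.1 integral_undef hne
  have : ∀ x : ℝ, Real.exp (-s * x) * x ^ (a - 1) / Real.Gamma a =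
      x ^ (a - 1) * Real.exp (-(s * x)) / Real.Gamma a := fun x => by ring_nf
  simp_rw [this]
  rw [← ofReal_integral_eq_lintegral_ofReal (hi.div_const _), integral_div, h]
  · rw [mul_div_cancel_right₀ _ hΓ.ne', one_div, Real.inv_rpow hs.le, Real.rpow_neg hs.le]
  · refine (ae_restrict_iff' measurableSet_Ioi).2 (ae_of_all _ fun x hx => ?_)
    have : 0 < x := hx
    simp only [Pi.zero_apply]; positivity

end Laplace

/-! ### Potential measures of the subordinator and moments of its first passage time. -/

section Potential

/-- Tempering shifts the Laplace variable of the stable law from s to s + μ, and the normalization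
contributes e^{tμ^α}. -/
theorem IsTemperedStableLaw.lintegral_exp {α μ t s : ℝ} {m : Measure ℝ≥0} (hμ : 0 ≤ μ)
    (hs : 0 ≤ s) (h : IsTemperedStableLaw α μ t m) :
    ∫⁻ x, ENNReal.ofReal (Real.exp (-s * x)) ∂m =
      ENNReal.ofReal (Real.exp (-t * ((s + μ) ^ α - μ ^ α))) := by
  obtain ⟨m₀, ⟨hprob, hL⟩, rfl⟩ := h
  rw [lintegral_withDensity_eq_lintegral_mul _ (by fun_prop) (by fun_prop)]
  have h1 : ∀ x : ℝ≥0, ENNReal.ofReal (Real.exp (-μ * x + μ ^ α * t)) *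
      ENNReal.ofReal (Real.exp (-s * x)) =
      ENNReal.ofReal (Real.exp (μ ^ α * t)) * ENNReal.ofReal (Real.exp (-(s + μ) * x)) := by
    intro x
    rw [← ENNReal.ofReal_mul (Real.exp_pos _).le, ← ENNReal.ofReal_mul (Real.exp_pos _).le,
      ← Real.exp_add, ← Real.exp_add]
    ring_nf
  simp only [Pi.mul_apply, h1]
  have hint : Integrable (fun x : ℝ≥0 => Real.exp (-(s + μ) * x)) m₀ := by
    refine Integrable.of_bound (by fun_prop) 1 (ae_of_all _ fun x => ?_)
    rw [Real.norm_of_nonneg (Real.exp_pos _).le, Real.exp_le_one_iff]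
    have : 0 ≤ (s + μ) * x := by positivity
    linarith
  rw [lintegral_const_mul _ (by fun_prop), ← ofReal_integral_eq_lintegral_ofReal hint
    (ae_of_all _ fun x => (Real.exp_pos _).le), hL _ (add_nonneg hs hμ),
    ← ENNReal.ofReal_mul (Real.exp_pos _).le, ← Real.exp_add]
  ring_nf

variable {Ω : Type*} [MeasurableSpace Ω] {P : Measure Ω}

theorem IsTemperedStableSubordinator.lintegral_exp {α μ s : ℝ} {S : ℝ≥0 → Ω → ℝ≥0}
    (hS : IsTemperedStableSubordinator α μ S P) (hμ : 0 ≤ μ) (hs : 0 ≤ s) (r : ℝ≥0) :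
    ∫⁻ ω, ENNReal.ofReal (Real.exp (-s * S r ω)) ∂P =
      ENNReal.ofReal (Real.exp (-r * ((s + μ) ^ α - μ ^ α))) := by
  have h := (hS.law 0 r zero_le).lintegral_exp hμ hs
  have hae : (fun ω => S r ω - S 0 ω) =ᵐ[P] S r := by
    filter_upwards [hS.paths] with ω hω
    simp [hω.1]
  rw [Measure.map_congr hae, lintegral_map (by fun_prop) (hS.measurable r)] at h
  simpa using h

/-- The Laplace exponent `s ↦ (s + ν) ^ β - ν ^ β` is positive on the positive half-line. -/
theorem laplaceExponent_pos {β ν s : ℝ} (hβ : 0 < β) (hν : 0 ≤ ν) (hs : 0 < s) :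
    0 < (s + ν) ^ β - ν ^ β :=
  sub_pos.2 (Real.rpow_lt_rpow hν (by linarith) hβ)

theorem lintegral_Ioi_pow_mul_exp {c : ℝ} (hc : 0 < c) (p : ℕ) :
    ∫⁻ r in Ioi (0 : ℝ), ENNReal.ofReal (r ^ p / p !) * ENNReal.ofReal (Real.exp (-r * c)) =
      ENNReal.ofReal ((c ^ (p + 1))⁻¹) := by
  have h := lintegral_Ioi_exp_mul_rpow (a := (p : ℝ) + 1) (by positivity) hc
  simp only [add_sub_cancel_right, Real.rpow_natCast] at h
  rw [Real.rpow_neg hc.le, Real.Gamma_nat_eq_factorial, ← Nat.cast_add_one,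
    Real.rpow_natCast] at h
  rw [← h]
  refine setLIntegral_congr_fun measurableSet_Ioi fun r hr => ?_
  have : 0 < r := hr
  rw [← ENNReal.ofReal_mul (by positivity)]
  congr 1
  ring_nf

/-- The measure `∫ r ^ p / p! * ℙ(D r ∈ ·) dr` of a process `D`. -/
noncomputable def potential (D : ℝ≥0 → Ω → ℝ≥0) (P : Measure Ω) (p : ℕ) : Measure ℝ :=
  ((volume.restrict (Ioi 0)).withDensity fun r : ℝ => ENNReal.ofReal (r ^ p / p !)).bind
    fun r => P.map fun ω => (D r.toNNReal ω : ℝ)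

/-- The density of the potential of order `p` of a tempered stable subordinator. -/
noncomputable def potentialDensity (β ν : ℝ) (p : ℕ) (x : ℝ) : ℝ≥0∞ :=
  ∑' j : ℕ, ENNReal.ofReal ((j + p).choose p * (ν ^ β) ^ j) *
    ENNReal.ofReal (Real.exp (-ν * x) * x ^ (β * (p + 1 + j) - 1) / Real.Gamma (β * (p + 1 + j)))

theorem measurable_potentialDensity (β ν : ℝ) (p : ℕ) : Measurable (potentialDensity β ν p) :=
  Measurable.tsum fun j => by fun_prop

/-- With z = ν^β(s+ν)^{-β} in [0, 1), the right side is (s+ν)^{-β(p+1)}(1-z)^{-(p+1)}. The negative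
binomial series makes it a combination of the powers (s+ν)^{-β(p+1+j)}, each the Laplace transform
of an exponentially tempered power of x. -/
theorem laplace_potentialDensity {β ν s : ℝ} (hβ : 0 < β) (hν : 0 ≤ ν) (hs : 0 < s) (p : ℕ) :
    ∫⁻ x, ENNReal.ofReal (Real.exp (-s * x))
      ∂((volume.restrict (Ioi 0)).withDensity (potentialDensity β ν p)) =
      ENNReal.ofReal ((((s + ν) ^ β - ν ^ β) ^ (p + 1))⁻¹) := by
  have hsν : 0 < s + ν := by linarith
  rw [lintegral_withDensity_eq_lintegral_mul _ (measurable_potentialDensity β ν p) (by fun_prop)]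
  have h1 : ∀ x : ℝ, (potentialDensity β ν p * fun x => ENNReal.ofReal (Real.exp (-s * x))) x =
      ∑' j : ℕ, ENNReal.ofReal ((j + p).choose p * (ν ^ β) ^ j) *
        ENNReal.ofReal (Real.exp (-(s + ν) * x) * x ^ (β * (p + 1 + j) - 1) /
          Real.Gamma (β * (p + 1 + j))) := by
    intro x
    rw [Pi.mul_apply, potentialDensity, ← ENNReal.tsum_mul_right]
    refine tsum_congr fun j => ?_
    rw [mul_assoc, ← ENNReal.ofReal_mul' (Real.exp_pos _).le]
    congr 2
    rw [show -(s + ν) * x = -ν * x + -s * x by ring, Real.exp_add]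
    ring
  simp_rw [h1]
  rw [lintegral_tsum fun j => by fun_prop]
  have hz0 : 0 ≤ ν ^ β * (s + ν) ^ (-β) := by positivity
  have hφ := laplaceExponent_pos hβ hν hs
  have hb : 0 < (s + ν) ^ β := by positivity
  have hz1 : ν ^ β * (s + ν) ^ (-β) < 1 := by
    rw [Real.rpow_neg hsν.le, ← div_eq_mul_inv, div_lt_one hb]; linarith
  have hsum := hasSum_choose_mul_geometric_of_norm_lt_one p
    (r := ν ^ β * (s + ν) ^ (-β)) (by rwa [Real.norm_of_nonneg hz0])
  have hsum2 := hsum.mul_left ((((s + ν) ^ β) ^ (p + 1))⁻¹)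
  have e : (((s + ν) ^ β) ^ (p + 1))⁻¹ * (1 / (1 - ν ^ β * (s + ν) ^ (-β)) ^ (p + 1)) =
      (((s + ν) ^ β - ν ^ β) ^ (p + 1))⁻¹ := by
    rw [one_div, ← mul_inv, ← mul_pow, Real.rpow_neg hsν.le]
    congr 2
    field_simp
  rw [← e, ← hsum2.tsum_eq, ENNReal.ofReal_tsum_of_nonneg (fun j => by positivity) hsum2.summable]
  refine tsum_congr fun j => ?_
  rw [lintegral_const_mul _ (by fun_prop), lintegral_Ioi_exp_mul_rpow (by positivity) hsν,
    ← ENNReal.ofReal_mul (by positivity)]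
  congr 1
  have e2 : (s + ν) ^ (-(β * (p + 1 + j))) =
      (((s + ν) ^ β) ^ (p + 1))⁻¹ * ((s + ν) ^ (-β)) ^ j := by
    rw [← Real.rpow_natCast, ← Real.rpow_natCast, ← Real.rpow_mul hsν.le, ← Real.rpow_mul hsν.le,
      ← Real.rpow_neg hsν.le, ← Real.rpow_add hsν]
    push_cast
    ring_nf
  rw [e2, mul_pow]
  ring

variable {β ν : ℝ} {D : ℝ≥0 → Ω → ℝ≥0}

/-- Needed to form the mixture in `potential`. Monotone paths make r ↦ ℙ(D_r ≤ x) antitone, hence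
measurable, and half-lines generate the Borel sets. -/
theorem IsTemperedStableSubordinator.measurable_law [IsProbabilityMeasure P]
    (hD : IsTemperedStableSubordinator β ν D P) :
    Measurable fun r : ℝ => P.map fun ω => (D r.toNNReal ω : ℝ) := by
  have hm : ∀ r : ℝ, Measurable fun ω => (D r.toNNReal ω : ℝ) := fun r =>
    (hD.measurable _).coe_nnreal_real
  have : ∀ r : ℝ, IsProbabilityMeasure (P.map fun ω => (D r.toNNReal ω : ℝ)) := fun r =>
    Measure.isProbabilityMeasure_map (hm r).aemeasurable
  refine .measure_of_isPiSystem_of_isProbabilityMeasure (borel_eq_generateFrom_Iic ℝ)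
    isPiSystem_Iic ?_
  rintro _ ⟨x, rfl⟩
  refine Antitone.measurable fun r r' hr => ?_
  rw [Measure.map_apply (hm _) measurableSet_Iic, Measure.map_apply (hm _) measurableSet_Iic]
  refine measure_mono_ae ?_
  filter_upwards [hD.paths] with ω hω
  exact fun h : (D r'.toNNReal ω : ℝ) ≤ x => show (D r.toNNReal ω : ℝ) ≤ x from
    (NNReal.coe_le_coe.2 (hω.2.1 (Real.toNNReal_mono hr))).trans h

theorem IsTemperedStableSubordinator.laplace_potential [IsProbabilityMeasure P]
    (hD : IsTemperedStableSubordinator β ν D P) (hβ : 0 < β) (hν : 0 ≤ ν) {s : ℝ} (hs : 0 < s)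
    (p : ℕ) : ∫⁻ x, ENNReal.ofReal (Real.exp (-s * x)) ∂(potential D P p) =
      ENNReal.ofReal ((((s + ν) ^ β - ν ^ β) ^ (p + 1))⁻¹) := by
  have hm : Measurable fun r : ℝ => ∫⁻ x, ENNReal.ofReal (Real.exp (-s * x))
      ∂(P.map fun ω => (D r.toNNReal ω : ℝ)) :=
    (Measure.measurable_lintegral (by fun_prop)).comp hD.measurable_law
  rw [potential, Measure.lintegral_bind hD.measurable_law.aemeasurable (by fun_prop),
    lintegral_withDensity_eq_lintegral_mul _ (by fun_prop) hm,
    ← lintegral_Ioi_pow_mul_exp (laplaceExponent_pos hβ hν hs) p]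
  refine setLIntegral_congr_fun measurableSet_Ioi fun r hr => ?_
  have hr : 0 < r := hr
  simp only [Pi.mul_apply]
  rw [lintegral_map (by fun_prop) (hD.measurable _).coe_nnreal_real,
    hD.lintegral_exp hν hs.le, Real.coe_toNNReal _ hr.le]

theorem IsTemperedStableSubordinator.potential_eq [IsProbabilityMeasure P]
    (hD : IsTemperedStableSubordinator β ν D P) (hβ : 0 < β) (hν : 0 ≤ ν) (p : ℕ) :
    potential D P p = (volume.restrict (Ioi 0)).withDensity (potentialDensity β ν p) := by
  refine measure_ext_of_laplace_eq (fun s hs => ?_) fun s hs => ?_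
  · rw [hD.laplace_potential hβ hν hs]; exact ENNReal.ofReal_ne_top
  · rw [hD.laplace_potential hβ hν hs, laplace_potentialDensity hβ hν hs]

theorem prabhakarTerm_nonneg {a b c z : ℝ} (ha : 0 ≤ a) (hb : 0 < b) (hc : 0 ≤ c) (hz : 0 ≤ z)
    (n : ℕ) : 0 ≤ prabhakarTerm a b c z n := by
  have h1 : 0 ≤ (ascPochhammer ℝ n).eval c := by
    induction n with
    | zero => simp
    | succ n ih => rw [ascPochhammer_succ_eval]; positivity
  have h2 : 0 < Real.Gamma (a * n + b) := Real.Gamma_pos_of_pos (by positivity)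
  unfold prabhakarTerm
  positivity

/-- The density is integrated term by term and the sums over j and m are exchanged. Since (p+1)_j =
j! binom(j+p, p), the negative binomial weights become the Pochhammer symbols of the Prabhakar
series. -/
theorem IsTemperedStableSubordinator.potential_Iic [IsProbabilityMeasure P]
    (hD : IsTemperedStableSubordinator β ν D P) (hβ : 0 < β) (hν : 0 ≤ ν) (p : ℕ) (t : ℝ≥0) :
    potential D P p (Iic (t : ℝ)) = ∑' m : ℕ, ∑' j : ℕ,
      ENNReal.ofReal (Real.exp (-((t : ℝ) * ν)) * ((t : ℝ) ^ m * ν ^ m * ((t : ℝ) ^ β) ^ (p + 1)) *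
        prabhakarTerm β (β * (p + 1 : ℕ) + m + 1) (p + 1 : ℕ) ((t : ℝ) ^ β * ν ^ β) j) := by
  rw [hD.potential_eq hβ hν, withDensity_apply _ measurableSet_Iic,
    Measure.restrict_restrict measurableSet_Iic, inter_comm, Ioi_inter_Iic, ENNReal.tsum_comm]
  unfold potentialDensity
  rw [lintegral_tsum fun j => by fun_prop]
  refine tsum_congr fun j => ?_
  rw [lintegral_const_mul _ (by fun_prop),
    lintegral_Ioc_exp_mul_rpow (by positivity) t.coe_nonneg hν, ← ENNReal.tsum_mul_left]
  refine tsum_congr fun m => ?_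
  rw [← ENNReal.ofReal_mul (by positivity)]
  congr 1
  have e1 : (t : ℝ) ^ (β * (p + 1 + j) + m) =
      ((t : ℝ) ^ β) ^ (p + 1) * ((t : ℝ) ^ β) ^ j * (t : ℝ) ^ m := by
    rw [Real.rpow_add_of_nonneg t.coe_nonneg (by positivity) (by positivity), mul_add,
      Real.rpow_add_of_nonneg t.coe_nonneg (by positivity) (by positivity), Real.rpow_natCast,
      ← Real.rpow_mul_natCast t.coe_nonneg, ← Real.rpow_mul_natCast t.coe_nonneg]
    push_cast
    rfl
  have e2 : (ascPochhammer ℝ j).eval ((p + 1 : ℕ) : ℝ) = j ! * (j + p).choose p := by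
    rw [ascPochhammer_nat_eq_natCast_ascFactorial, Nat.ascFactorial_eq_factorial_mul_choose,
      add_comm p j, Nat.choose_symm_add]
    push_cast
    rfl
  have e3 : β * (p + 1 + j) + m + 1 = β * j + (β * ((p + 1 : ℕ) : ℝ) + m + 1) := by
    push_cast; ring
  rw [prabhakarTerm, e1, e2, e3, mul_pow]
  field_simp

/-- Chernoff bound: the indicator of x ≤ t is at most e^{st}e^{-sx}. The parameter s stays free so
that the decay rate in p can be made arbitrarily large. -/
theorem IsTemperedStableSubordinator.potential_Iic_le [IsProbabilityMeasure P]
    (hD : IsTemperedStableSubordinator β ν D P) (hβ : 0 < β) (hν : 0 ≤ ν) (p : ℕ) (t : ℝ≥0)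
    {s : ℝ} (hs : 0 < s) :
    potential D P p (Iic (t : ℝ)) ≤
      ENNReal.ofReal (Real.exp (s * t) * (((s + ν) ^ β - ν ^ β) ^ (p + 1))⁻¹) := by
  rw [ENNReal.ofReal_mul (Real.exp_pos _).le, ← hD.laplace_potential hβ hν hs,
    ← lintegral_const_mul _ (by fun_prop), ← lintegral_indicator_one measurableSet_Iic]
  refine lintegral_mono fun x => ?_
  by_cases hx : x ∈ Iic (t : ℝ)
  swap
  · simp [hx]
  rw [indicator_of_mem hx, Pi.one_apply]
  rw [← ENNReal.ofReal_mul (Real.exp_pos _).le, ← Real.exp_add]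
  refine ENNReal.one_le_ofReal.2 (Real.one_le_exp ?_)
  have : x ≤ t := hx
  nlinarith

/-- `Y` is, up to null sets, the first passage time of `D` above the level `t`. -/
structure IsFirstPassage (D : ℝ≥0 → Ω → ℝ≥0) (t : ℝ≥0) (Y : Ω → ℝ≥0) (P : Measure Ω) : Prop where
  measurable : Measurable Y
  le_of_lt : ∀ r, 0 < r → ∀ᵐ ω ∂P, r < Y ω → D r ω ≤ t
  le_of_le : ∀ r, 0 < r → ∀ᵐ ω ∂P, D r ω ≤ t → r ≤ Y ω

/-- Layer-cake formula. The bounds ℙ(r < Y) ≤ ℙ(D_r ≤ t) ≤ ℙ(r ≤ Y) become equalities for almost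
every r, because the outer two differ only at atoms of Y. -/
theorem IsFirstPassage.lintegral_pow [IsProbabilityMeasure P] {t : ℝ≥0} {Y : Ω → ℝ≥0}
    (hY : IsFirstPassage D t Y P) (hD : IsTemperedStableSubordinator β ν D P) (p : ℕ) :
    ∫⁻ ω, ENNReal.ofReal ((Y ω : ℝ) ^ (p + 1) / (p + 1)!) ∂P = potential D P p (Iic (t : ℝ)) := by
  have hYm : Measurable fun ω => (Y ω : ℝ) := hY.measurable.coe_nnreal_real
  have h := lintegral_comp_eq_lintegral_meas_lt_mul P (f := fun ω => (Y ω : ℝ))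
    (g := fun r => r ^ p / p !) (ae_of_all _ fun ω => (Y ω).2) hYm.aemeasurable
    (fun r _ => Continuous.intervalIntegrable (by fun_prop) _ _)
    ((ae_restrict_iff' measurableSet_Ioi).2 (ae_of_all _ fun r hr => by
      have : 0 < r := hr
      positivity))
  have e : ∀ y : ℝ, ∫ r in (0 : ℝ)..y, r ^ p / p ! = y ^ (p + 1) / (p + 1)! := by
    intro y
    rw [intervalIntegral.integral_div, integral_pow, Nat.factorial_succ]
    push_cast
    field_simp
    ring
  simp only [e] at h
  have hm : Measurable fun r : ℝ => (P.map fun ω => (D r.toNNReal ω : ℝ)) (Iic (t : ℝ)) :=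
    (Measure.measurable_coe measurableSet_Iic).comp hD.measurable_law
  rw [h, potential, Measure.bind_apply measurableSet_Iic hD.measurable_law.aemeasurable,
    lintegral_withDensity_eq_lintegral_mul _ (by fun_prop) hm]
  refine lintegral_congr_ae ?_
  filter_upwards [meas_le_ae_eq_meas_lt P (volume.restrict (Ioi 0)) fun ω => (Y ω : ℝ),
    ae_restrict_mem measurableSet_Ioi] with r hr hr0
  have hr0 : 0 < r := hr0
  have hr1 : 0 < r.toNNReal := Real.toNNReal_pos.2 hr0
  rw [Pi.mul_apply, mul_comm, Measure.map_apply (hD.measurable _).coe_nnreal_real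
    measurableSet_Iic]
  congr 1
  refine le_antisymm (measure_mono_ae ?_) (hr ▸ measure_mono_ae ?_)
  · filter_upwards [hY.le_of_lt _ hr1] with ω hω h'
    exact NNReal.coe_le_coe.2 (hω ((Real.toNNReal_lt_iff_lt_coe hr0.le).2 h'))
  · filter_upwards [hY.le_of_le _ hr1] with ω hω h'
    exact Real.toNNReal_le_iff_le_coe.1 (hω (NNReal.coe_le_coe.1 h'))

end Potential

/-! ### Evaluation at independent random times, and the generating function. -/

section Subordination

variable {Ω : Type*} [MeasurableSpace Ω] {P : Measure Ω}

theorem measurable_comp_nat_index {E : Type*} [MeasurableSpace E] {V : ℕ → Ω → E} {Q : Ω → ℕ}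
    (hV : ∀ j, Measurable (V j)) (hQ : Measurable Q) : Measurable fun ω => V (Q ω) ω :=
  (measurable_from_prod_countable_left (f := fun x : Ω × ℕ => V x.2 x.1) hV).comp
    (measurable_id.prodMk hQ)

/-- Split over the events {Q = j}; on each, independence of `W j` and Q factors the integral. -/
theorem integral_indep_nat_index [IsProbabilityMeasure P] {W : ℕ → Ω → ℝ} {Q : Ω → ℕ}
    (hW : ∀ j, Measurable (W j)) (hb : ∀ j ω, |W j ω| ≤ 1) (hQ : Measurable Q)
    (hind : ∀ j, IndepFun (W j) Q P) :
    ∫ ω, W (Q ω) ω ∂P = ∫ ω, (∫ ω', W (Q ω) ω' ∂P) ∂P := by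
  have hm : ∀ j, MeasurableSet (Q ⁻¹' {j}) := fun j => hQ (measurableSet_singleton j)
  have hU : (⋃ j, Q ⁻¹' {j}) = univ := by ext; simp
  have hd : Pairwise fun i j => Disjoint (Q ⁻¹' {i}) (Q ⁻¹' {j}) := fun i j hij =>
    Disjoint.preimage Q (by simpa using hij)
  have hWQ : Measurable fun ω => W (Q ω) ω := measurable_comp_nat_index hW hQ
  have hG : Measurable fun ω => ∫ ω', W (Q ω) ω' ∂P :=
    (Measurable.of_discrete (f := fun j => ∫ ω', W j ω' ∂P)).comp hQ
  have hbi : ∀ j, |∫ ω', W j ω' ∂P| ≤ 1 := fun j => by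
    simpa using norm_integral_le_of_norm_le_const (μ := P) (f := W j) (ae_of_all _ (hb j))
  have i1 : Integrable (fun ω => W (Q ω) ω) P :=
    .of_bound hWQ.aestronglyMeasurable 1 (ae_of_all _ fun ω => hb _ ω)
  have i2 : Integrable (fun ω => ∫ ω', W (Q ω) ω' ∂P) P :=
    .of_bound hG.aestronglyMeasurable 1 (ae_of_all _ fun ω => hbi _)
  have h1 := hasSum_integral_iUnion hm hd i1.integrableOn
  have h2 := hasSum_integral_iUnion hm hd i2.integrableOn
  rw [hU, setIntegral_univ] at h1 h2
  refine h1.unique (h2.congr_fun fun j => ?_)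
  have e1 : ∫ ω in Q ⁻¹' {j}, W (Q ω) ω ∂P = ∫ ω in Q ⁻¹' {j}, W j ω ∂P :=
    setIntegral_congr_fun (hm j) fun ω hω => by rw [show Q ω = j from hω]
  have e2 : ∫ ω in Q ⁻¹' {j}, ∫ ω', W (Q ω) ω' ∂P ∂P =
      ∫ ω in Q ⁻¹' {j}, ∫ ω', W j ω' ∂P ∂P :=
    setIntegral_congr_fun (hm j) fun ω hω => by simp only [show Q ω = j from hω]
  rw [e1, e2, setIntegral_const, ← integral_indicator (hm j)]
  have hI : IndepFun (fun ω => (({j} : Set ℕ).indicator (fun _ => (1 : ℝ)) (Q ω))) (W j) P :=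
    (hind j).symm.comp (Measurable.of_discrete (f := ({j} : Set ℕ).indicator fun _ => (1 : ℝ)))
      measurable_id
  have h3 := hI.integral_fun_mul_eq_mul_integral
    ((Measurable.of_discrete (f := ({j} : Set ℕ).indicator fun _ => (1 : ℝ))).comp
      hQ).aestronglyMeasurable (hW j).aestronglyMeasurable
  have e3 : (Q ⁻¹' {j}).indicator (W j) =
      fun ω => ({j} : Set ℕ).indicator (fun _ => (1 : ℝ)) (Q ω) * W j ω := by
    ext ω
    by_cases h : Q ω = j <;> simp [indicator, h]
  have e4 : ∫ ω, ({j} : Set ℕ).indicator (fun _ => (1 : ℝ)) (Q ω) ∂P = P.real (Q ⁻¹' {j}) := by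
    rw [← integral_indicator_one (hm j)]
    rfl
  rw [e3, h3, e4, smul_eq_mul]

/-- The smallest multiple of `1 / (n + 1)` that exceeds `x`. -/
noncomputable def gridAbove (n : ℕ) (x : ℝ≥0) : ℝ≥0 := (⌊(n + 1) * x⌋₊ + 1) / (n + 1)

theorem le_gridAbove (n : ℕ) (x : ℝ≥0) : x ≤ gridAbove n x := by
  rw [gridAbove, le_div_iff₀ (by positivity), mul_comm]
  exact (Nat.lt_floor_add_one _).le

/-- The approximation is from the right because paths are only right-continuous. -/
theorem tendsto_gridAbove (x : ℝ≥0) :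
    Tendsto (fun n => gridAbove n x) atTop (𝓝[Ici x] x) := by
  refine tendsto_nhdsWithin_iff.2 ⟨?_, Eventually.of_forall fun n => le_gridAbove n x⟩
  have h1 : Tendsto (fun n : ℕ => x + 1 / ((n : ℝ≥0) + 1)) atTop (𝓝 (x + 0)) :=
    tendsto_const_nhds.add tendsto_one_div_add_atTop_nhds_zero_nat
  rw [add_zero] at h1
  refine tendsto_of_tendsto_of_tendsto_of_le_of_le tendsto_const_nhds h1
    (fun n => le_gridAbove n x) fun n => ?_
  rw [gridAbove, div_le_iff₀ (by positivity), add_mul x, div_mul_cancel₀ _ (by positivity),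
    mul_comm x]
  gcongr
  exact Nat.floor_le (by positivity)

theorem measurable_comp_gridAbove {E : Type*} [MeasurableSpace E] {X : ℝ≥0 → Ω → E} {T : Ω → ℝ≥0}
    (hX : ∀ r, Measurable (X r)) (hT : Measurable T) (n : ℕ) :
    Measurable fun ω => X (gridAbove n (T ω)) ω := by
  have hQ : Measurable fun ω => ⌊(n + 1) * T ω⌋₊ := Nat.measurable_floor.comp (by fun_prop)
  exact measurable_comp_nat_index (V := fun j => X ((j + 1) / (n + 1))) (fun j => hX _) hQ

section RandomTime

variable {E : Type*} [TopologicalSpace E] {X : ℝ≥0 → Ω → E} {T : Ω → ℝ≥0}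

theorem tendsto_comp_gridAbove
    (hrc : ∀ᵐ ω ∂P, ∀ r, ContinuousWithinAt (fun s => X s ω) (Ici r) r) :
    ∀ᵐ ω ∂P, Tendsto (fun n => X (gridAbove n (T ω)) ω) atTop (𝓝 (X (T ω) ω)) := by
  filter_upwards [hrc] with ω hω
  exact (hω (T ω)).tendsto.comp (tendsto_gridAbove _)

theorem aemeasurable_comp_time [MeasurableSpace E] [TopologicalSpace.PseudoMetrizableSpace E]
    [BorelSpace E] (hX : ∀ r, Measurable (X r)) (hT : Measurable T)
    (hrc : ∀ᵐ ω ∂P, ∀ r, ContinuousWithinAt (fun s => X s ω) (Ici r) r) :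
    AEMeasurable (fun ω => X (T ω) ω) P :=
  aemeasurable_of_tendsto_metrizable_ae atTop
    (fun n => (measurable_comp_gridAbove hX hT n).aemeasurable) (tendsto_comp_gridAbove hrc)

/-- No joint measurability of Z is assumed. The discretized time takes countably many values, where
`integral_indep_nat_index` applies; right-continuity and dominated convergence then pass to the
limit on both sides. -/
theorem integral_comp_indep_time [IsProbabilityMeasure P] {Z : ℝ≥0 → Ω → ℝ}
    (hZ : ∀ r, Measurable (Z r)) (hb : ∀ r ω, |Z r ω| ≤ 1)
    (hrc : ∀ᵐ ω ∂P, ∀ r, ContinuousWithinAt (fun s => Z s ω) (Ici r) r)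
    (hT : Measurable T) (hind : ∀ r, IndepFun (Z r) T P) :
    ∫ ω, Z (T ω) ω ∂P = ∫ ω, (∫ ω', Z (T ω) ω' ∂P) ∂P := by
  have hbi : ∀ r, |∫ ω', Z r ω' ∂P| ≤ 1 := fun r => by
    simpa using norm_integral_le_of_norm_le_const (μ := P) (f := Z r) (ae_of_all _ (hb r))
  have hlim1 : Tendsto (fun n => ∫ ω, Z (gridAbove n (T ω)) ω ∂P) atTop
      (𝓝 (∫ ω, Z (T ω) ω ∂P)) :=
    tendsto_integral_of_dominated_convergence (fun _ => 1)
      (fun n => (measurable_comp_gridAbove hZ hT n).aestronglyMeasurable) (integrable_const _)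
      (fun n => ae_of_all _ fun ω => hb _ ω) (tendsto_comp_gridAbove hrc)
  have hlim2 : Tendsto (fun n => ∫ ω, (∫ ω', Z (gridAbove n (T ω)) ω' ∂P) ∂P) atTop
      (𝓝 (∫ ω, (∫ ω', Z (T ω) ω' ∂P) ∂P)) := by
    refine tendsto_integral_of_dominated_convergence (fun _ => 1) (fun n => ?_)
      (integrable_const _) (fun n => ae_of_all _ fun ω => hbi _) (ae_of_all _ fun ω => ?_)
    · exact (measurable_comp_gridAbove (X := fun r _ => ∫ ω', Z r ω' ∂P)
        (fun r => measurable_const) hT n).aestronglyMeasurable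
    · refine tendsto_integral_of_dominated_convergence (fun _ => 1)
        (fun n => (hZ _).aestronglyMeasurable) (integrable_const _)
        (fun n => ae_of_all _ fun ω => hb _ ω) ?_
      filter_upwards [hrc] with ω' hω'
      exact (hω' (T ω)).tendsto.comp (tendsto_gridAbove _)
  refine tendsto_nhds_unique hlim1 (hlim2.congr fun n => ?_)
  have hQ : Measurable fun ω => ⌊(n + 1) * T ω⌋₊ := Nat.measurable_floor.comp (by fun_prop)
  exact (integral_indep_nat_index (W := fun j => Z ((j + 1) / (n + 1))) (fun j => hZ _)
    (fun j => hb _) hQ fun j => (hind _).comp measurable_id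
      (Nat.measurable_floor.comp (f := fun x : ℝ≥0 => (n + 1) * x) (by fun_prop))).symm

end RandomTime

/-- The first passage time of a path above the level `t`, as a countable infimum. -/
noncomputable def firstPassage (t : ℝ≥0) (d : ℝ≥0 → ℝ≥0) : ℝ≥0 :=
  (⨅ n : ℕ, if t < d (TopologicalSpace.denseSeq ℝ≥0 n) then
    (TopologicalSpace.denseSeq ℝ≥0 n : ℝ≥0∞) else ⊤).toNNReal

theorem measurable_firstPassage (t : ℝ≥0) : Measurable (firstPassage t) := by
  refine ENNReal.measurable_toNNReal.comp (Measurable.iInf fun n => ?_)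
  exact Measurable.ite (measurableSet_lt measurable_const (measurable_pi_apply _))
    measurable_const measurable_const

/-- For a monotone path the set {t < d} is upward closed, so a dense sequence already detects its
infimum. The countable form is a measurable functional of the whole path, as the independence
arguments require. -/
theorem firstPassage_eq {t : ℝ≥0} {d : ℝ≥0 → ℝ≥0} (hd : Monotone d) (h0 : d 0 = 0) :
    firstPassage t d = sInf {r : ℝ≥0 | 0 < r ∧ t < d r} := by
  have hpos : ∀ r, t < d r → 0 < r := fun r hr => by
    rcases eq_or_ne r 0 with rfl | h
    · simp [h0] at hr
    · exact pos_iff_ne_zero.2 h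
  unfold firstPassage
  set q := TopologicalSpace.denseSeq ℝ≥0
  -- If the level is never passed, both default values, `sInf ∅` and `⊤.toNNReal`, are 0.
  rcases {r : ℝ≥0 | 0 < r ∧ t < d r}.eq_empty_or_nonempty with he | hne
  · have : ∀ r, ¬ t < d r := fun r hr => by
      have : r ∈ {r : ℝ≥0 | 0 < r ∧ t < d r} := ⟨hpos r hr, hr⟩
      simp [he] at this
    simp [this]
  · suffices h : (⨅ n : ℕ, if t < d (q n) then (q n : ℝ≥0∞) else ⊤) =
        (sInf {r : ℝ≥0 | 0 < r ∧ t < d r} : ℝ≥0) by rw [h, ENNReal.toNNReal_coe]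
    refine le_antisymm (ENNReal.le_of_forall_pos_le_add ?_) (le_iInf fun n => ?_)
    · intro ε hε _
      obtain ⟨r, hr, hrε⟩ := exists_lt_of_csInf_lt hne (lt_add_of_pos_right _ hε)
      obtain ⟨n, hn⟩ := (TopologicalSpace.denseRange_denseSeq ℝ≥0).exists_mem_open isOpen_Ioo
        (nonempty_Ioo.2 hrε)
      refine (iInf_le _ n).trans ?_
      rw [if_pos (hr.2.trans_le (hd hn.1.le))]
      exact_mod_cast hn.2.le
    · split_ifs with h
      · exact ENNReal.coe_le_coe.2 (csInf_le (OrderBot.bddBelow _) ⟨hpos _ h, h⟩)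
      · exact le_top

variable {β ν : ℝ} {D : ℝ≥0 → Ω → ℝ≥0}

/-- Markov's inequality for e^{-D} at time n + 1 gives the bound e^t e^{-(n+1)c}, which tends to 0.
This excludes the spurious value 0 of the infimum of an empty set. -/
theorem IsTemperedStableSubordinator.ae_exists_lt [IsProbabilityMeasure P]
    (hD : IsTemperedStableSubordinator β ν D P) (hβ : 0 < β) (hν : 0 ≤ ν) (t : ℝ≥0) :
    ∀ᵐ ω ∂P, ∃ r, 0 < r ∧ t < D r ω := by
  have hc := laplaceExponent_pos hβ hν one_pos
  set c := (1 + ν) ^ β - ν ^ β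
  have hbound : ∀ n : ℕ, P {ω | ¬ ∃ r, 0 < r ∧ t < D r ω} ≤
      ENNReal.ofReal (Real.exp t * Real.exp (-((n : ℝ) + 1) * c)) := by
    intro n
    have h1 := hD.lintegral_exp hν zero_le_one (n + 1)
    have h2 := mul_meas_ge_le_lintegral (μ := P)
      (f := fun ω => ENNReal.ofReal (Real.exp (-1 * D (n + 1) ω)))
      (by have := hD.measurable (n + 1); fun_prop) (ENNReal.ofReal (Real.exp (-t)))
    rw [h1] at h2
    have h3 : P {ω | ¬ ∃ r, 0 < r ∧ t < D r ω} ≤ P {ω | ENNReal.ofReal (Real.exp (-t)) ≤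
        ENNReal.ofReal (Real.exp (-1 * D (n + 1) ω))} := by
      refine measure_mono fun ω hω => ENNReal.ofReal_le_ofReal (Real.exp_le_exp.2 ?_)
      have hω : ¬ ∃ r, 0 < r ∧ t < D r ω := hω
      push Not at hω
      have := NNReal.coe_le_coe.2 (hω (n + 1) (by positivity))
      linarith
    calc P {ω | ¬ ∃ r, 0 < r ∧ t < D r ω}
        = ENNReal.ofReal (Real.exp t) * (ENNReal.ofReal (Real.exp (-t)) *
          P {ω | ¬ ∃ r, 0 < r ∧ t < D r ω}) := by
          rw [← mul_assoc, ← ENNReal.ofReal_mul (Real.exp_pos _).le, ← Real.exp_add]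
          simp
      _ ≤ ENNReal.ofReal (Real.exp t) * ENNReal.ofReal (Real.exp (-((n : ℝ) + 1) * c)) := by
          gcongr
          refine (mul_le_mul_right h3 _).trans (h2.trans_eq ?_)
          push_cast
          rfl
      _ = _ := (ENNReal.ofReal_mul (Real.exp_pos _).le).symm
  have hlim : Tendsto (fun n : ℕ => ENNReal.ofReal
      (Real.exp t * Real.exp (-((n : ℝ) + 1) * c))) atTop (𝓝 0) := by
    rw [← ENNReal.ofReal_zero, ← mul_zero (Real.exp t)]
    refine ENNReal.tendsto_ofReal (Tendsto.const_mul _ (Real.tendsto_exp_atBot.comp ?_))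
    refine Tendsto.atBot_mul_const hc (tendsto_neg_atTop_atBot.comp ?_)
    exact tendsto_atTop_add_const_right _ _ tendsto_natCast_atTop_atTop
  exact le_antisymm (ge_of_tendsto' hlim hbound) zero_le

theorem IsTemperedStableSubordinator.isFirstPassage [IsProbabilityMeasure P]
    (hD : IsTemperedStableSubordinator β ν D P) (hβ : 0 < β) (hν : 0 ≤ ν) (t : ℝ≥0) :
    IsFirstPassage D t (fun ω => firstPassage t fun r => D r ω) P where
  measurable := (measurable_firstPassage t).comp (measurable_pi_lambda _ hD.measurable)
  le_of_lt r hr := by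
    filter_upwards [hD.paths] with ω hω h
    rw [firstPassage_eq hω.2.1 hω.1] at h
    by_contra! hlt
    have : r ∈ {r : ℝ≥0 | 0 < r ∧ t < D r ω} := ⟨hr, hlt⟩
    exact absurd (csInf_le (OrderBot.bddBelow _) this) (not_le.2 h)
  le_of_le r hr := by
    filter_upwards [hD.paths, hD.ae_exists_lt hβ hν t] with ω hω hex h
    rw [firstPassage_eq hω.2.1 hω.1]
    refine le_csInf hex fun r' hr' => ?_
    by_contra! hlt
    exact absurd hr'.2 (not_lt.2 ((hω.2.1 hlt.le).trans h))

theorem IsPoissonProcess.real_eq [IsProbabilityMeasure P] {lam : ℝ≥0} {N : ℝ≥0 → Ω → ℕ}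
    (hN : IsPoissonProcess lam N P) (r : ℝ≥0) (k : ℕ) :
    P.real {ω | N r ω = k} = Real.exp (-(lam * r)) * (lam * r) ^ k / k ! := by
  have h := hN.law 0 r zero_le
  have hae : (fun ω => N r ω - N 0 ω) =ᵐ[P] N r := by
    filter_upwards [hN.paths] with ω hω
    simp [hω.1]
  rw [Measure.map_congr hae] at h
  have h2 := congrArg (fun m => m.real {k}) h
  simp only [poissonMeasure_real_singleton] at h2
  rw [map_measureReal_apply (hN.measurable r) (measurableSet_singleton k)] at h2
  have e : {ω | N r ω = k} = N r ⁻¹' {k} := rfl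
  rw [e]
  simpa using h2

/-- Given T = S(Y), the count is Poisson with generating function e^{-λ(1-u)T}. Given Y, the Laplace
transform of S at λ(1-u) finishes the computation. -/
theorem hasSum_stateProbability [IsProbabilityMeasure P] {α μ : ℝ} {lam : ℝ≥0}
    {N : ℝ≥0 → Ω → ℕ} {S : ℝ≥0 → Ω → ℝ≥0} (hμ : 0 ≤ μ)
    (hN : IsPoissonProcess lam N P) (hS : IsTemperedStableSubordinator α μ S P)
    (hD : IsTemperedStableSubordinator β ν D P)
    (hSD : IndepFun (fun ω t => S t ω) (fun ω t => D t ω) P)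
    (hNSD : IndepFun (fun ω t => N t ω) (fun ω => (fun t => S t ω, fun t => D t ω)) P)
    (t : ℝ≥0) {u : ℝ} (hu : |u| < 1) :
    HasSum (fun k : ℕ => P.real {ω | N (S (inverseProcess D t ω) ω) ω = k} * u ^ k)
      (∫ ω, Real.exp (-(firstPassage t fun r => D r ω) *
        ((lam * (1 - u) + μ) ^ α - μ ^ α)) ∂P) := by
  set Y : Ω → ℝ≥0 := fun ω => firstPassage t fun r => D r ω
  have hY : Measurable Y := (measurable_firstPassage t).comp (measurable_pi_lambda _ hD.measurable)
  have hSrc : ∀ᵐ ω ∂P, ∀ r, ContinuousWithinAt (fun s => S s ω) (Ici r) r :=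
    hS.paths.mono fun ω hω => hω.2.2
  have hNrc : ∀ᵐ ω ∂P, ∀ r, ContinuousWithinAt (fun s => N s ω) (Ici r) r :=
    hN.paths.mono fun ω hω => hω.2.2
  -- Evaluating a path at a random time is not obviously measurable on the product space. This
  -- limsup is a measurable functional of both paths, so T is independent of N, and it equals S(Y)
  -- almost surely by right-continuity.
  set τ : (ℝ≥0 → ℝ≥0) × (ℝ≥0 → ℝ≥0) → ℝ≥0 := fun p =>
    limsup (fun n => p.1 (gridAbove n (firstPassage t p.2))) atTop
  have hτ : Measurable τ := Measurable.limsup fun n =>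
    measurable_comp_gridAbove (X := fun r (p : (ℝ≥0 → ℝ≥0) × (ℝ≥0 → ℝ≥0)) => p.1 r)
      (fun r => (measurable_pi_apply r).comp measurable_fst)
      ((measurable_firstPassage t).comp measurable_snd) n
  have hSDm : Measurable fun ω => ((fun t => S t ω), (fun t => D t ω)) :=
    (measurable_pi_lambda _ hS.measurable).prodMk (measurable_pi_lambda _ hD.measurable)
  set T : Ω → ℝ≥0 := fun ω => τ (fun t => S t ω, fun t => D t ω)
  have hT : Measurable T := hτ.comp hSDm
  have hTS : ∀ᵐ ω ∂P, T ω = S (Y ω) ω := by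
    filter_upwards [tendsto_comp_gridAbove (T := Y) hSrc] with ω hω
    exact hω.limsup_eq
  have hYinv : ∀ᵐ ω ∂P, inverseProcess D t ω = Y ω := by
    filter_upwards [hD.paths] with ω hω
    exact (firstPassage_eq hω.2.1 hω.1).symm
  have hp : ∀ k : ℕ, P.real {ω | N (S (inverseProcess D t ω) ω) ω = k} =
      ∫ ω, (Real.exp (-(lam * T ω)) * (lam * T ω) ^ k / (k ! : ℝ)) ∂P := by
    intro k
    have e1 : P.real {ω | N (S (inverseProcess D t ω) ω) ω = k} = P.real {ω | N (T ω) ω = k} := by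
      refine measureReal_congr ?_
      filter_upwards [hTS, hYinv] with ω h1 h2
      refine propext ?_
      change N (S (inverseProcess D t ω) ω) ω = k ↔ N (T ω) ω = k
      rw [h1, h2]
    set g : ℕ → ℝ := fun j => if j = k then 1 else 0
    have hZ : ∀ r, Measurable fun ω => g (N r ω) := fun r =>
      (Measurable.of_discrete (f := g)).comp (hN.measurable r)
    have hind : ∀ r, IndepFun (fun ω => g (N r ω)) T P := fun r =>
      hNSD.comp ((Measurable.of_discrete (f := g)).comp (measurable_pi_apply r)) hτ
    have h := integral_comp_indep_time hZ (fun r ω => by simp only [g]; split_ifs <;> simp)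
      (hNrc.mono fun ω hω r => (continuous_of_discreteTopology (f := g)).continuousAt.comp_continuousWithinAt
        (hω r)) hT hind
    have hNT : AEMeasurable (fun ω => N (T ω) ω) P := aemeasurable_comp_time hN.measurable hT hNrc
    have e2 : ∀ {M : Ω → ℕ}, AEMeasurable M P → ∫ ω, g (M ω) ∂P = P.real {ω | M ω = k} := by
      intro M hM
      have : (fun ω => g (M ω)) = (M ⁻¹' {k}).indicator fun _ => 1 := by
        ext ω; simp [g, indicator]
      rw [this, integral_indicator₀ (hM.nullMeasurableSet_preimage (measurableSet_singleton k)),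
        setIntegral_const, smul_eq_mul, mul_one]
      rfl
    rw [e1, ← e2 hNT, h]
    refine integral_congr_ae (ae_of_all _ fun ω => ?_)
    simp only
    rw [e2 (hN.measurable _).aemeasurable, hN.real_eq]
  have hpint : ∀ k : ℕ, Integrable (fun ω => Real.exp (-(lam * T ω)) * (lam * T ω) ^ k / k !) P := by
    intro k
    refine Integrable.of_bound (by fun_prop) 1 (ae_of_all _ fun ω => ?_)
    rw [Real.norm_of_nonneg (by positivity), mul_div_assoc]
    have := Real.pow_div_factorial_le_exp (x := lam * T ω) (by positivity) k
    calc _ ≤ Real.exp (-(lam * T ω)) * Real.exp (lam * T ω) := by gcongr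
      _ = 1 := by rw [← Real.exp_add]; simp
  have hsum := hasSum_integral_of_summable_integral_norm (μ := P)
    (F := fun (k : ℕ) ω => Real.exp (-(lam * T ω)) * (lam * T ω) ^ k / k ! * u ^ k)
    (fun k => (hpint k).mul_const _) (by
      refine Summable.of_nonneg_of_le (fun k => integral_nonneg fun ω => norm_nonneg _) (fun k => ?_)
        (summable_geometric_of_lt_one (abs_nonneg u) hu)
      have : ∀ ω, ‖Real.exp (-(lam * T ω)) * (lam * T ω) ^ k / k ! * u ^ k‖ =
          Real.exp (-(lam * T ω)) * (lam * T ω) ^ k / k ! * |u| ^ k := fun ω => by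
        rw [norm_mul, Real.norm_of_nonneg (by positivity), norm_pow, Real.norm_eq_abs]
      simp_rw [this]
      rw [integral_mul_const, ← hp k]
      exact mul_le_of_le_one_left (by positivity) measureReal_le_one)
  simp_rw [integral_mul_const, ← hp] at hsum
  refine (show ∀ x, x = ∫ ω, ∑' k : ℕ, Real.exp (-(lam * T ω)) * (lam * T ω) ^ k / k ! * u ^ k ∂P →
    HasSum (fun k : ℕ => P.real {ω | N (S (inverseProcess D t ω) ω) ω = k} * u ^ k) x from
    fun x hx => hx ▸ hsum) _ ?_
  have hs : 0 ≤ (lam : ℝ) * (1 - u) := by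
    have := (abs_lt.1 hu).2
    exact mul_nonneg lam.2 (by linarith)
  have hpt : ∀ ω, ∑' k : ℕ, Real.exp (-(lam * T ω)) * (lam * T ω) ^ k / k ! * u ^ k =
      Real.exp (-(lam * (1 - u)) * T ω) := by
    intro ω
    have h1 : HasSum (fun k : ℕ => (lam * T ω * u) ^ k / k !) (Real.exp (lam * T ω * u)) := by
      have := NormedSpace.expSeries_div_hasSum_exp (𝔸 := ℝ) (lam * T ω * u)
      rwa [← Real.exp_eq_exp_ℝ] at this
    have h2 := h1.mul_left (Real.exp (-(lam * T ω)))
    rw [← Real.exp_add] at h2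
    rw [show -(lam * (1 - u)) * T ω = -(lam * T ω) + lam * T ω * u by ring, ← h2.tsum_eq]
    refine tsum_congr fun k => ?_
    rw [mul_pow _ u]
    ring
  simp_rw [hpt]
  have hZ : ∀ r, Measurable fun ω => Real.exp (-(lam * (1 - u)) * S r ω) := fun r => by
    have := hS.measurable r
    fun_prop
  have h := integral_comp_indep_time (T := Y) hZ
    (fun r ω => by
      rw [abs_of_pos (Real.exp_pos _), Real.exp_le_one_iff]
      have : 0 ≤ (lam : ℝ) * (1 - u) * S r ω := mul_nonneg hs (S r ω).2
      linarith)
    (hSrc.mono fun ω hω r => by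
      have : Continuous fun x : ℝ≥0 => Real.exp (-(lam * (1 - u)) * x) := by fun_prop
      exact this.continuousAt.comp_continuousWithinAt (hω r)) hY
    (fun r => by
      have he : Measurable fun s : ℝ≥0 → ℝ≥0 => Real.exp (-(lam * (1 - u)) * s r) := by fun_prop
      exact hSD.comp he (measurable_firstPassage t))
  have e3 : ∫ ω, Real.exp (-(lam * (1 - u)) * T ω) ∂P =
      ∫ ω, Real.exp (-(lam * (1 - u)) * S (Y ω) ω) ∂P :=
    integral_congr_ae (hTS.mono fun ω hω => by simp only [hω])
  rw [e3, h]
  refine integral_congr_ae (ae_of_all _ fun ω => ?_)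
  simp only
  rw [integral_eq_lintegral_of_nonneg_ae (ae_of_all _ fun ω => (Real.exp_pos _).le)
    (hZ _).aestronglyMeasurable, hS.lintegral_exp hμ hs,
    ENNReal.toReal_ofReal (Real.exp_pos _).le]

end Subordination

/-! ### Generalized binomial series and the power series of the Laplace exponent. -/

section Binomial

/-- Both sides equal binom(l+k, k) binom(a, l+k). The exchange frees the factor depending on k from
the sum over l. -/
theorem choose_mul_choose_comm (a : ℝ) (l k : ℕ) :
    Ring.choose a l * Ring.choose (a - l) k = Ring.choose a k * Ring.choose (a - k) l := by
  have h1 := Ring.choose_smul_choose a (Nat.le_add_right l k)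
  have h2 := Ring.choose_smul_choose a (Nat.le_add_left k l)
  rw [Nat.add_sub_cancel_left] at h1
  rw [Nat.add_sub_cancel] at h2
  rw [← h1, ← h2, Nat.choose_symm_add]

theorem choose_succ_mul (a : ℝ) (k : ℕ) :
    Ring.choose a (k + 1) * (k + 1) = Ring.choose a k * (a - k) := by
  have h := Ring.choose_smul_choose a (Nat.le_succ k)
  rw [Nat.succ_eq_add_one, Nat.choose_succ_self_right, Nat.add_sub_cancel_left,
    Ring.choose_one_right, nsmul_eq_mul] at h
  rw [← h]
  push_cast
  ring

/-- Induction on k comparing successive ratios, using |a - k| ≤ a + k. The majorant is the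
coefficient of x^k in (1-x)^{-a}. -/
theorem abs_choose_le {a : ℝ} (ha : 0 ≤ a) (k : ℕ) :
    |Ring.choose a k| ≤ Ring.choose (a + k - 1) k := by
  rw [← Ring.multichoose_eq]
  have hm : ∀ k : ℕ, Ring.multichoose a (k + 1) * (k + 1) = Ring.multichoose a k * (a + k) := by
    intro k
    have h1 := Ring.factorial_nsmul_multichoose_eq_ascPochhammer a k
    have h2 := Ring.factorial_nsmul_multichoose_eq_ascPochhammer a (k + 1)
    rw [Polynomial.ascPochhammer_smeval_eq_eval, nsmul_eq_mul] at h1 h2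
    rw [ascPochhammer_succ_eval, ← h1, Nat.factorial_succ] at h2
    have : (k ! : ℝ) ≠ 0 := by positivity
    push_cast at h2
    apply mul_left_cancel₀ this
    linarith
  induction k with
  | zero => simp
  | succ k ih =>
    have hk : (0 : ℝ) < k + 1 := by positivity
    rw [← mul_le_mul_iff_left₀ hk, hm, ← abs_of_pos hk, ← abs_mul, choose_succ_mul, abs_mul]
    have : |a - k| ≤ a + k := abs_le.2 ⟨by linarith, by linarith [(Nat.cast_nonneg k : (0 : ℝ) ≤ k)]⟩
    exact mul_le_mul ih this (abs_nonneg _) ((abs_nonneg _).trans ih)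

theorem hasSum_choose_mul_pow (a : ℝ) {x : ℝ} (hx : |x| < 1) :
    HasSum (fun l : ℕ => Ring.choose a l * x ^ l) ((1 + x) ^ a) := by
  have h := (Real.one_add_rpow_hasFPowerSeriesOnBall_zero (a := a)).hasSum (y := x)
    (by simpa [enorm_eq_nnnorm, ← NNReal.coe_lt_coe] using hx)
  simpa [binomialSeries, FormalMultilinearSeries.ofScalars] using h

theorem hasSum_choose_add_mul_pow (a : ℝ) {x : ℝ} (hx : |x| < 1) :
    HasSum (fun l : ℕ => Ring.choose (a + l - 1) l * x ^ l) (((1 - x) ^ a)⁻¹) := by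
  have h := (Real.one_div_one_sub_rpow_hasFPowerSeriesOnBall_zero a).hasSum (y := x)
    (by simpa [enorm_eq_nnnorm, ← NNReal.coe_lt_coe] using hx)
  simpa [FormalMultilinearSeries.ofScalars, one_div] using h

theorem hasSum_choose_mul_pow_natCast (n : ℕ) (x : ℝ) :
    HasSum (fun l : ℕ => Ring.choose (n : ℝ) l * x ^ l) ((1 + x) ^ n) := by
  have h : (1 + x) ^ n = ∑ l ∈ Finset.range (n + 1), Ring.choose (n : ℝ) l * x ^ l := by
    rw [add_comm, add_pow]
    refine Finset.sum_congr rfl fun l _ => ?_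
    rw [Ring.choose_natCast]
    ring
  rw [h]
  refine hasSum_sum_of_ne_finset_zero fun l hl => ?_
  rw [Ring.choose_natCast, Nat.choose_eq_zero_of_lt (by simpa [Nat.lt_succ_iff] using hl)]
  simp

/-- After the exchange of binomials, the sum over l is the series of (1+μ/λ)^{αn-k}. It converges
when μ < λ. For α = 1 it is a finite sum when k ≤ n, and when k > n the prefactor binom(n, k)
vanishes. -/
theorem hasSum_binomTerm {α μ lam : ℝ} (hμ : 0 ≤ μ) (hlam : 0 < lam)
    (h : μ < lam ∨ α = 1) (k n : ℕ) :
    HasSum (binomTerm α μ lam k n)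
      (Ring.choose (α * n) k * lam ^ k * (lam + μ) ^ (α * n - k)) := by
  have hterm : ∀ l : ℕ, binomTerm α μ lam k n l =
      Ring.choose (α * n) k * lam ^ (α * n) * (Ring.choose (α * n - k) l * (μ / lam) ^ l) := by
    intro l
    rw [binomTerm, choose_mul_choose_comm, Real.rpow_sub hlam, Real.rpow_natCast, div_pow]
    ring
  have hx : 0 ≤ μ / lam := by positivity
  have hval : ∀ b : ℝ, Ring.choose b k * lam ^ k * (lam + μ) ^ (b - k) =
      Ring.choose b k * lam ^ b * (1 + μ / lam) ^ (b - k) := by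
    intro b
    rw [show lam + μ = lam * (1 + μ / lam) by field_simp, Real.mul_rpow hlam.le (by positivity),
      Real.rpow_sub hlam, Real.rpow_natCast]
    field_simp
  rw [hval, funext hterm]
  rcases h with h | rfl
  · refine (hasSum_choose_mul_pow _ ?_).mul_left _
    rwa [abs_of_nonneg hx, div_lt_one hlam]
  · rw [one_mul]
    rcases le_or_gt k n with hk | hk
    · rw [← Nat.cast_sub hk, Real.rpow_natCast (1 + μ / lam)]
      exact (hasSum_choose_mul_pow_natCast _ _).mul_left _
    · rw [Ring.choose_natCast, Nat.choose_eq_zero_of_lt hk]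
      simp

/-- The coefficient of `u ^ k` in `((lam * (1 - u) + μ) ^ α - μ ^ α) ^ n`. -/
noncomputable def exponentCoeff (α μ lam : ℝ) (n k : ℕ) : ℝ :=
  (-1) ^ k * ∑ h ∈ Finset.range (n + 1), (n.choose h : ℝ) * (-(μ ^ α)) ^ (n - h) *
    (Ring.choose (α * h) k * lam ^ k * (lam + μ) ^ (α * h - k))

section ExponentCoeff

variable {α μ lam u : ℝ}

theorem abs_ratio_lt_one (hμ : 0 ≤ μ) (hlam : 0 < lam) (hu : |u| < 1) :
    |lam * u / (lam + μ)| < 1 := by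
  rw [abs_div, abs_of_pos (by linarith : 0 < lam + μ), div_lt_one (by linarith), abs_mul,
    abs_of_pos hlam]
  nlinarith

/-- Factor λ(1-u)+μ = (λ+μ)(1-v) with v = λu/(λ+μ), |v| < 1. Then expand the n-th power by the
binomial theorem and each (1-v)^{αh} by the binomial series. -/
theorem hasSum_exponentCoeff (hμ : 0 ≤ μ) (hlam : 0 < lam) (hu : |u| < 1) (n : ℕ) :
    HasSum (fun k => exponentCoeff α μ lam n k * u ^ k)
      (((lam * (1 - u) + μ) ^ α - μ ^ α) ^ n) := by
  have hs : 0 < lam + μ := by linarith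
  have hv := abs_ratio_lt_one hμ hlam hu
  set v := lam * u / (lam + μ) with hvdef
  have hv1 : 0 < 1 + -v := by linarith [(abs_lt.1 hv).2]
  have hbase : lam * (1 - u) + μ = (lam + μ) * (1 + -v) := by
    rw [hvdef]; field_simp; ring
  have hpow : ((lam * (1 - u) + μ) ^ α - μ ^ α) ^ n =
      ∑ h ∈ Finset.range (n + 1), (n.choose h : ℝ) * (-(μ ^ α)) ^ (n - h) *
        ((lam + μ) ^ (α * h) * (1 + -v) ^ (α * h)) := by
    rw [sub_eq_add_neg, add_pow]
    refine Finset.sum_congr rfl fun h _ => ?_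
    rw [← Real.mul_rpow hs.le hv1.le, ← hbase, Real.rpow_mul_natCast (by rw [hbase]; positivity)]
    ring
  rw [hpow]
  have hterm : ∀ k, exponentCoeff α μ lam n k * u ^ k =
      ∑ h ∈ Finset.range (n + 1), (n.choose h : ℝ) * (-(μ ^ α)) ^ (n - h) *
        ((lam + μ) ^ (α * h) * (Ring.choose (α * h) k * (-v) ^ k)) := by
    intro k
    rw [exponentCoeff, Finset.mul_sum, Finset.sum_mul]
    refine Finset.sum_congr rfl fun h _ => ?_
    rw [Real.rpow_sub hs, Real.rpow_natCast, neg_pow v, hvdef, div_pow, mul_pow]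
    field_simp
  rw [funext hterm]
  refine hasSum_sum fun h _ => ((hasSum_choose_mul_pow _ ?_).mul_left _).mul_left _
  rwa [abs_neg]

/-- A bound for `∑ k, |exponentCoeff α μ lam 1 k| * |u| ^ k`. -/
noncomputable def exponentBound (α μ lam u : ℝ) : ℝ :=
  μ ^ α + ((lam + μ) / (1 - lam * |u| / (lam + μ))) ^ α

theorem exponentBound_nonneg (hμ : 0 ≤ μ) (hlam : 0 < lam) (hu : |u| < 1) :
    0 ≤ exponentBound α μ lam u := by
  have hv := abs_ratio_lt_one (u := |u|) hμ hlam (by rwa [abs_abs])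
  have hv1 : 0 < 1 - lam * |u| / (lam + μ) := by linarith [(abs_lt.1 hv).2]
  unfold exponentBound
  positivity

/-- Taking absolute values in both expansions turns -μ^α into μ^α and (1-v)^{αh} into (1-|v|)^{-αh}.
The majorant resums to an exact n-th power, so the growth in n is geometric. -/
theorem summable_abs_exponentCoeff (hα : 0 < α) (hμ : 0 ≤ μ) (hlam : 0 < lam) (hu : |u| < 1)
    (n : ℕ) : Summable (fun k => |exponentCoeff α μ lam n k * u ^ k|) ∧
      ∑' k, |exponentCoeff α μ lam n k * u ^ k| ≤ exponentBound α μ lam u ^ n := by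
  have hs : 0 < lam + μ := by linarith
  have hv := abs_ratio_lt_one (u := |u|) hμ hlam (by rwa [abs_abs])
  unfold exponentBound
  set v := lam * |u| / (lam + μ) with hvdef
  have hv0 : 0 ≤ v := by positivity
  have hv1 : 0 < 1 - v := by linarith [(abs_lt.1 hv).2]
  have hpow : (μ ^ α + ((lam + μ) / (1 - v)) ^ α) ^ n =
      ∑ h ∈ Finset.range (n + 1), (n.choose h : ℝ) * (μ ^ α) ^ (n - h) *
        ((lam + μ) ^ (α * h) * ((1 - v) ^ (α * h))⁻¹) := by
    rw [add_comm, add_pow]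
    refine Finset.sum_congr rfl fun h _ => ?_
    rw [← div_eq_mul_inv, ← Real.div_rpow hs.le hv1.le, ← Real.rpow_mul_natCast (by positivity)]
    ring
  have hbound : ∀ k, |exponentCoeff α μ lam n k * u ^ k| ≤
      ∑ h ∈ Finset.range (n + 1), (n.choose h : ℝ) * (μ ^ α) ^ (n - h) *
        ((lam + μ) ^ (α * h) * (Ring.choose (α * h + k - 1) k * v ^ k)) := by
    intro k
    rw [exponentCoeff, abs_mul, abs_mul, abs_pow, abs_neg, abs_one, one_pow, one_mul, abs_pow]
    refine (mul_le_mul_of_nonneg_right (Finset.abs_sum_le_sum_abs _ _) (by positivity)).trans ?_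
    rw [Finset.sum_mul]
    refine Finset.sum_le_sum fun h _ => ?_
    have e : |(n.choose h : ℝ) * (-(μ ^ α)) ^ (n - h) *
        (Ring.choose (α * h) k * lam ^ k * (lam + μ) ^ (α * h - k))| * |u| ^ k =
        (n.choose h : ℝ) * (μ ^ α) ^ (n - h) *
        ((lam + μ) ^ (α * h) * (|Ring.choose (α * h) k| * v ^ k)) := by
      rw [Real.rpow_sub hs, Real.rpow_natCast, hvdef, div_pow, mul_pow]
      simp only [abs_mul, abs_pow, abs_neg, abs_div, Nat.abs_cast, abs_of_pos hlam, abs_of_pos hs,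
        abs_of_nonneg (Real.rpow_nonneg hμ α), abs_of_nonneg (Real.rpow_nonneg hs.le (α * h))]
      field_simp
    rw [e]
    gcongr
    exact abs_choose_le (by positivity) k
  have hsum : HasSum (fun k : ℕ => ∑ h ∈ Finset.range (n + 1), (n.choose h : ℝ) * (μ ^ α) ^ (n - h) *
        ((lam + μ) ^ (α * h) * (Ring.choose (α * h + k - 1) k * v ^ k)))
      ((μ ^ α + ((lam + μ) / (1 - v)) ^ α) ^ n) := by
    rw [hpow]
    exact hasSum_sum fun h _ => ((hasSum_choose_add_mul_pow _ hv).mul_left _).mul_left _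
  have hS := Summable.of_nonneg_of_le (fun k => abs_nonneg _) hbound hsum.summable
  exact ⟨hS, hsum.tsum_eq ▸ hS.tsum_le_tsum hbound hsum.summable⟩

/-- A Cauchy-type estimate for a single coefficient; 1/2 is an arbitrary point of (0, 1). -/
theorem abs_exponentCoeff_le (hα : 0 < α) (hμ : 0 ≤ μ) (hlam : 0 < lam) (n k : ℕ) :
    |exponentCoeff α μ lam n k| ≤ 2 ^ k * exponentBound α μ lam (1 / 2) ^ n := by
  obtain ⟨h1, h2⟩ := summable_abs_exponentCoeff (u := 1 / 2) hα hμ hlam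
    (by rw [abs_of_pos] <;> norm_num) n
  have h3 := (h1.le_tsum k fun j _ => abs_nonneg _).trans h2
  rw [abs_mul, abs_of_pos (by positivity : (0 : ℝ) < (1 / 2) ^ k)] at h3
  calc |exponentCoeff α μ lam n k|
      = 2 ^ k * (|exponentCoeff α μ lam n k| * (1 / 2) ^ k) := by
        rw [one_div, inv_pow]; field_simp
    _ ≤ _ := by gcongr

end ExponentCoeff

end Binomial

/-! ### Moment expansion of the first passage time. -/

section Expansion

theorem coeff_eq_of_hasSum_pow {a b : ℕ → ℝ} {f : ℝ → ℝ}
    (ha : ∀ u, |u| < 1 → HasSum (fun k => a k * u ^ k) (f u))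
    (hb : ∀ u, |u| < 1 → HasSum (fun k => b k * u ^ k) (f u)) : a = b := by
  have aux : ∀ {c : ℕ → ℝ}, (∀ u, |u| < 1 → HasSum (fun k => c k * u ^ k) (f u)) →
      HasFPowerSeriesAt f (FormalMultilinearSeries.ofScalars ℝ c) 0 := by
    intro c hc
    rw [hasFPowerSeriesAt_iff]
    have : ∀ᶠ u : ℝ in 𝓝 0, |u| < 1 := by
      have := Metric.ball_mem_nhds (0 : ℝ) one_pos
      filter_upwards [this] with u hu
      simpa using hu
    filter_upwards [this] with u hu
    simpa [mul_comm] using hc u hu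
  have h := (aux ha).eq_formalMultilinearSeries (aux hb)
  ext k
  have := congrArg (fun p => FormalMultilinearSeries.coeff p k) h
  simpa using this

/-- Γ(x+1) = xΓ(x) with x ≥ 1 at every step. This gives bounds uniform in m. -/
theorem prabhakarTerm_add_natCast_le {a b c z : ℝ} (ha : 0 ≤ a) (hb : 1 ≤ b) (hc : 0 ≤ c)
    (hz : 0 ≤ z) (m n : ℕ) : prabhakarTerm a (b + m) c z n ≤ prabhakarTerm a b c z n := by
  induction m with
  | zero => simp
  | succ m ih =>
    refine le_trans ?_ ih
    have hx : 1 ≤ a * n + (b + m) := by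
      have : 0 ≤ a * n := by positivity
      have : (0 : ℝ) ≤ m := by positivity
      linarith
    have hpos : 0 < a * n + (b + m) := by linarith
    have hΓ : 0 < Real.Gamma (a * n + (b + m)) := Real.Gamma_pos_of_pos hpos
    have e : prabhakarTerm a (b + (m + 1 : ℕ)) c z n =
        prabhakarTerm a (b + m) c z n / (a * n + (b + m)) := by
      rw [prabhakarTerm, prabhakarTerm, show a * n + (b + (m + 1 : ℕ)) = a * n + (b + m) + 1 by
        push_cast; ring, Real.Gamma_add_one hpos.ne']
      field_simp
    rw [e]
    exact div_le_self (prabhakarTerm_nonneg ha (by positivity) hc hz n) hx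

theorem prabhakarTerm_zero_param (a b z : ℝ) (n : ℕ) :
    prabhakarTerm a b 0 z n = if n = 0 then (Real.Gamma b)⁻¹ else 0 := by
  rw [prabhakarTerm]
  split_ifs with h
  · subst h; simp
  · rw [ascPochhammer_eval_zero, if_neg h]
    simp

theorem exists_lt_laplaceExponent {β : ℝ} (hβ : 0 < β) (ν K : ℝ) :
    ∃ s, 0 < s ∧ K < (s + ν) ^ β - ν ^ β := by
  have h : Tendsto (fun s : ℝ => (s + ν) ^ β - ν ^ β) atTop atTop :=
    tendsto_atTop_add_const_right _ _ ((tendsto_rpow_atTop hβ).comp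
      (tendsto_atTop_add_const_right _ _ tendsto_id))
  obtain ⟨s, h1, h2⟩ := ((eventually_gt_atTop 0).and (h.eventually_gt_atTop K)).exists
  exact ⟨s, h1, h2⟩

variable {Ω : Type*} [MeasurableSpace Ω] {P : Measure Ω} {β ν : ℝ} {D : ℝ≥0 → Ω → ℝ≥0}
  {t : ℝ≥0} {Y : Ω → ℝ≥0}

/-- The summand with index `m` in the expansion of the `n`-th normalized moment of the
first passage time above `t`. -/
noncomputable def momentTerm (β ν t : ℝ) (n m : ℕ) : ℝ :=
  Real.exp (-(t * ν)) * (t ^ m * ν ^ m * (t ^ β) ^ n) *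
    prabhakar β (β * n + m + 1) n (t ^ β * ν ^ β)

namespace IsFirstPassage

theorem lintegral_pow_eq_tsum [IsProbabilityMeasure P] (hY : IsFirstPassage D t Y P)
    (hD : IsTemperedStableSubordinator β ν D P) (hβ : 0 < β) (hν : 0 ≤ ν) (n : ℕ) :
    ∫⁻ ω, ENNReal.ofReal ((Y ω : ℝ) ^ n / n !) ∂P = ∑' m : ℕ, ∑' j : ℕ,
      ENNReal.ofReal (Real.exp (-((t : ℝ) * ν)) * ((t : ℝ) ^ m * ν ^ m * ((t : ℝ) ^ β) ^ n) *
        prabhakarTerm β (β * n + m + 1) n ((t : ℝ) ^ β * ν ^ β) j) := by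
  cases n with
  | succ p => rw [hY.lintegral_pow hD, hD.potential_Iic hβ hν]
  -- Potentials only reach the moments of order at least 1. For n = 0 the Prabhakar function reduces
  -- to 1/m!, and the sum is the exponential series of tν times e^{-tν}.
  | zero =>
    have h1 : HasSum (fun m : ℕ => Real.exp (-((t : ℝ) * ν)) * ((t * ν) ^ m / m !)) 1 := by
      have := (NormedSpace.expSeries_div_hasSum_exp (𝔸 := ℝ) ((t : ℝ) * ν)).mul_left
        (Real.exp (-((t : ℝ) * ν)))
      rwa [← Real.exp_eq_exp_ℝ, ← Real.exp_add, neg_add_cancel, Real.exp_zero] at this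
    have h2 : ∫⁻ ω, ENNReal.ofReal ((Y ω : ℝ) ^ 0 / 0!) ∂P = ENNReal.ofReal 1 := by simp
    have h3 : ENNReal.ofReal 1 =
        ENNReal.ofReal (∑' m : ℕ, Real.exp (-((t : ℝ) * ν)) * ((t * ν) ^ m / m !)) := by
      rw [h1.tsum_eq]
    rw [h2, h3, ENNReal.ofReal_tsum_of_nonneg (fun m => by positivity) h1.summable]
    refine tsum_congr fun m => ?_
    rw [tsum_eq_single 0]
    · rw [Nat.cast_zero, prabhakarTerm_zero_param, if_pos rfl, mul_zero, zero_add,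
        Real.Gamma_nat_eq_factorial, mul_pow]
      congr 1
      ring
    · intro j hj
      rw [Nat.cast_zero, prabhakarTerm_zero_param, if_neg hj]
      simp

theorem lintegral_pow_le [IsProbabilityMeasure P] (hY : IsFirstPassage D t Y P)
    (hD : IsTemperedStableSubordinator β ν D P) (hβ : 0 < β) (hν : 0 ≤ ν) {s : ℝ} (hs : 0 < s)
    (n : ℕ) : ∫⁻ ω, ENNReal.ofReal ((Y ω : ℝ) ^ n / n !) ∂P ≤
      ENNReal.ofReal (Real.exp (s * t) * (((s + ν) ^ β - ν ^ β) ^ n)⁻¹) := by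
  cases n with
  | succ p => rw [hY.lintegral_pow hD]; exact hD.potential_Iic_le hβ hν p t hs
  | zero =>
    have : 0 ≤ s * t := mul_nonneg hs.le t.2
    simpa using this

theorem integrable_pow [IsProbabilityMeasure P] (hY : IsFirstPassage D t Y P)
    (hD : IsTemperedStableSubordinator β ν D P) (hβ : 0 < β) (hν : 0 ≤ ν) (n : ℕ) :
    Integrable (fun ω => (Y ω : ℝ) ^ n / n !) P := by
  have := hY.measurable
  refine ⟨by fun_prop, ?_⟩
  rw [hasFiniteIntegral_iff_ofReal (ae_of_all _ fun ω => by positivity)]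
  exact (hY.lintegral_pow_le hD hβ hν one_pos n).trans_lt ENNReal.ofReal_lt_top

theorem integral_pow_nonneg (n : ℕ) : 0 ≤ ∫ ω, ((Y ω : ℝ) ^ n / n !) ∂P :=
  integral_nonneg fun ω => by positivity

/-- Choosing s with φ(s) > K bounds the terms by e^{st}(K/φ(s))^n, a convergent geometric series. -/
theorem summable_pow_mul_integral_pow [IsProbabilityMeasure P] (hY : IsFirstPassage D t Y P)
    (hD : IsTemperedStableSubordinator β ν D P) (hβ : 0 < β) (hν : 0 ≤ ν) {K : ℝ} (hK : 0 ≤ K) :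
    Summable fun n : ℕ => K ^ n * ∫ ω, ((Y ω : ℝ) ^ n / n !) ∂P := by
  obtain ⟨s, hs, hKs⟩ := exists_lt_laplaceExponent hβ ν K
  have hc := laplaceExponent_pos hβ hν hs
  set c := (s + ν) ^ β - ν ^ β
  refine Summable.of_nonneg_of_le
    (fun n => mul_nonneg (by positivity) (integral_pow_nonneg n)) (fun n => ?_)
    ((summable_geometric_of_lt_one (r := K / c) (by positivity)
      ((div_lt_one hc).2 hKs)).mul_left (Real.exp (s * t)))
  have h := hY.lintegral_pow_le hD hβ hν hs n
  rw [← ofReal_integral_eq_lintegral_ofReal (hY.integrable_pow hD hβ hν n)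
    (ae_of_all _ fun ω => by positivity), ENNReal.ofReal_le_ofReal_iff (by positivity)] at h
  calc _ ≤ K ^ n * (Real.exp (s * t) * (c ^ n)⁻¹) := by gcongr
    _ = _ := by rw [div_pow]; ring

/-- Convergence is read off from finiteness of the moment: for t > 0 the inner series with m = 0 is,
up to a positive factor, one term of a finite sum of nonnegative series. Other m follow by
comparison. -/
theorem summable_prabhakarTerm [IsProbabilityMeasure P] (hY : IsFirstPassage D t Y P)
    (hD : IsTemperedStableSubordinator β ν D P) (hβ : 0 < β) (hν : 0 ≤ ν) (m n : ℕ) :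
    Summable (prabhakarTerm β (β * n + m + 1) n ((t : ℝ) ^ β * ν ^ β)) := by
  have hz : 0 ≤ (t : ℝ) ^ β * ν ^ β := by positivity
  -- At t = 0 that factor may vanish, but only the term j = 0 survives.
  rcases eq_or_ne t 0 with rfl | ht
  · refine summable_of_ne_finset_zero (s := {0}) fun j hj => ?_
    have : j ≠ 0 := by simpa using hj
    simp [prabhakarTerm, Real.zero_rpow hβ.ne', this]
  have ht : (0 : ℝ) < t := by positivity
  have h0 : Summable (prabhakarTerm β (β * n + 1) n ((t : ℝ) ^ β * ν ^ β)) := by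
    have h1 : ∫⁻ ω, ENNReal.ofReal ((Y ω : ℝ) ^ n / n !) ∂P ≠ ∞ :=
      ((hY.lintegral_pow_le hD hβ hν one_pos n).trans_lt ENNReal.ofReal_lt_top).ne
    rw [hY.lintegral_pow_eq_tsum hD hβ hν n] at h1
    have h2 := ENNReal.ne_top_of_tsum_ne_top h1 0
    simp only [pow_zero, Nat.cast_zero, add_zero, one_mul] at h2
    have hpos : 0 < Real.exp (-((t : ℝ) * ν)) * ((t : ℝ) ^ β) ^ n := by positivity
    have h3 := ENNReal.summable_toReal h2
    refine (summable_mul_left_iff hpos.ne').1 (h3.congr fun j => ?_)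
    exact ENNReal.toReal_ofReal (mul_nonneg hpos.le
      (prabhakarTerm_nonneg hβ.le (by positivity) n.cast_nonneg hz j))
  refine Summable.of_nonneg_of_le
    (fun j => prabhakarTerm_nonneg hβ.le (by positivity) n.cast_nonneg hz j) (fun j => ?_) h0
  rw [show β * n + m + 1 = β * n + 1 + (m : ℝ) by ring]
  exact prabhakarTerm_add_natCast_le hβ.le (by simp; positivity) n.cast_nonneg hz m j

theorem prabhakar_nonneg (hβ : 0 < β) (hν : 0 ≤ ν) (m n : ℕ) :
    0 ≤ prabhakar β (β * n + m + 1) n ((t : ℝ) ^ β * ν ^ β) :=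
  tsum_nonneg fun j =>
    prabhakarTerm_nonneg hβ.le (by positivity) n.cast_nonneg (by positivity) j

theorem prabhakar_le [IsProbabilityMeasure P] (hY : IsFirstPassage D t Y P)
    (hD : IsTemperedStableSubordinator β ν D P) (hβ : 0 < β) (hν : 0 ≤ ν) (m n : ℕ) :
    prabhakar β (β * n + m + 1) n ((t : ℝ) ^ β * ν ^ β) ≤
      prabhakar β (β * n + (0 : ℕ) + 1) n ((t : ℝ) ^ β * ν ^ β) := by
  refine (hY.summable_prabhakarTerm hD hβ hν m n).tsum_le_tsum (fun j => ?_)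
    (hY.summable_prabhakarTerm hD hβ hν 0 n)
  rw [show β * n + m + 1 = β * n + (0 : ℕ) + 1 + (m : ℝ) by push_cast; ring]
  exact prabhakarTerm_add_natCast_le hβ.le (by simp; positivity) n.cast_nonneg
    (by positivity) m j

theorem momentTerm_nonneg (hβ : 0 < β) (hν : 0 ≤ ν) (n m : ℕ) : 0 ≤ momentTerm β ν t n m :=
  mul_nonneg (by positivity) (prabhakar_nonneg hβ hν m n)

theorem hasSum_momentTerm [IsProbabilityMeasure P] (hY : IsFirstPassage D t Y P)
    (hD : IsTemperedStableSubordinator β ν D P) (hβ : 0 < β) (hν : 0 ≤ ν) (n : ℕ) :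
    HasSum (momentTerm β ν t n) (∫ ω, ((Y ω : ℝ) ^ n / n !) ∂P) := by
  have h := hY.lintegral_pow_eq_tsum hD hβ hν n
  have h1 : ∀ m : ℕ, ∑' j : ℕ,
      ENNReal.ofReal (Real.exp (-((t : ℝ) * ν)) * ((t : ℝ) ^ m * ν ^ m * ((t : ℝ) ^ β) ^ n) *
        prabhakarTerm β (β * n + m + 1) n ((t : ℝ) ^ β * ν ^ β) j) =
      ENNReal.ofReal (momentTerm β ν t n m) := by
    intro m
    rw [momentTerm, prabhakar, ← tsum_mul_left, ENNReal.ofReal_tsum_of_nonneg (fun j =>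
      mul_nonneg (by positivity)
        (prabhakarTerm_nonneg hβ.le (by positivity) n.cast_nonneg (by positivity) j))
      ((hY.summable_prabhakarTerm hD hβ hν m n).mul_left _)]
  simp_rw [h1] at h
  rw [integral_eq_lintegral_of_nonneg_ae (ae_of_all _ fun ω => by positivity)
    (hY.integrable_pow hD hβ hν n).aestronglyMeasurable, h]
  have hfin : ∑' m, ENNReal.ofReal (momentTerm β ν t n m) ≠ ∞ := by
    rw [← h]
    exact ((hY.lintegral_pow_le hD hβ hν one_pos n).trans_lt ENNReal.ofReal_lt_top).ne
  have h2 := ENNReal.hasSum_toReal hfin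
  rw [← ENNReal.tsum_toReal_eq fun m => ENNReal.ofReal_ne_top] at h2
  simpa only [ENNReal.toReal_ofReal (momentTerm_nonneg hβ hν n _)] using h2

theorem hasSum_integral_exp [IsProbabilityMeasure P] (hY : IsFirstPassage D t Y P)
    (hD : IsTemperedStableSubordinator β ν D P) (hβ : 0 < β) (hν : 0 ≤ ν) (x : ℝ) :
    HasSum (fun n : ℕ => (-1) ^ n * x ^ n * ∫ ω, ((Y ω : ℝ) ^ n / n !) ∂P)
      (∫ ω, Real.exp (-Y ω * x) ∂P) := by
  have h := hasSum_integral_of_summable_integral_norm (μ := P)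
    (F := fun (n : ℕ) ω => (-1) ^ n * x ^ n * ((Y ω : ℝ) ^ n / n !))
    (fun n => (hY.integrable_pow hD hβ hν n).const_mul _) (by
      refine (hY.summable_pow_mul_integral_pow hD hβ hν (abs_nonneg x)).congr fun n => ?_
      rw [← integral_const_mul]
      refine integral_congr_ae (ae_of_all _ fun ω => ?_)
      simp only [norm_mul, norm_pow, norm_neg, norm_one, one_pow, one_mul, Real.norm_eq_abs]
      rw [abs_of_nonneg (by positivity : 0 ≤ (Y ω : ℝ) ^ n / n !)])
  simp_rw [integral_const_mul] at h
  have e : ∀ ω, ∑' n : ℕ, (-1) ^ n * x ^ n * ((Y ω : ℝ) ^ n / n !) = Real.exp (-Y ω * x) := by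
    intro ω
    have h1 := NormedSpace.expSeries_div_hasSum_exp (𝔸 := ℝ) (-Y ω * x)
    rw [← Real.exp_eq_exp_ℝ] at h1
    rw [← h1.tsum_eq]
    refine tsum_congr fun n => ?_
    rw [mul_pow, neg_pow (Y ω : ℝ)]
    ring
  simpa only [e] using h

end IsFirstPassage

/-! ### Rearrangement into powers of u. -/

section Coefficients

variable {α μ lam : ℝ} {e : ℕ → ℝ}

theorem summable_mul_abs_exponentCoeff (hα : 0 < α) (hμ : 0 ≤ μ) (hlam : 0 < lam)
    (he : ∀ n, 0 ≤ e n) (hes : ∀ K : ℝ, 0 ≤ K → Summable fun n => K ^ n * e n) (k : ℕ) :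
    Summable fun n => e n * |exponentCoeff α μ lam n k| := by
  refine Summable.of_nonneg_of_le (fun n => mul_nonneg (he n) (abs_nonneg _)) (fun n => ?_)
    ((hes _ (exponentBound_nonneg (u := 1 / 2) (α := α) hμ hlam
      (by rw [abs_of_pos] <;> norm_num))).mul_left (2 ^ k))
  calc e n * |exponentCoeff α μ lam n k|
      ≤ e n * (2 ^ k * exponentBound α μ lam (1 / 2) ^ n) :=
        mul_le_mul_of_nonneg_left (abs_exponentCoeff_le hα hμ hlam n k) (he n)
    _ = _ := by ring

/-- Fubini for the double series in (n, k): the absolute sum over k is at most `exponentBound` to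
the power n, which the moments e_n absorb. -/
theorem hasSum_tsum_exponentCoeff (hα : 0 < α) (hμ : 0 ≤ μ) (hlam : 0 < lam)
    (he : ∀ n, 0 ≤ e n) (hes : ∀ K : ℝ, 0 ≤ K → Summable fun n => K ^ n * e n)
    {u : ℝ} (hu : |u| < 1) {x : ℝ}
    (hx : HasSum (fun n => (-1) ^ n * ((lam * (1 - u) + μ) ^ α - μ ^ α) ^ n * e n) x) :
    HasSum (fun k => (∑' n, (-1) ^ n * e n * exponentCoeff α μ lam n k) * u ^ k) x := by
  set F : ℕ × ℕ → ℝ := fun p => (-1) ^ p.1 * e p.1 * (exponentCoeff α μ lam p.1 p.2 * u ^ p.2)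
    with hF
  have hnorm : ∀ n k, ‖F (n, k)‖ = e n * |exponentCoeff α μ lam n k * u ^ k| := fun n k => by
    rw [hF]
    simp only [norm_mul, norm_pow, norm_neg, norm_one, one_pow, one_mul, Real.norm_eq_abs,
      abs_of_nonneg (he n), abs_mul, abs_pow]
  have hsum : Summable F := by
    refine Summable.of_norm ((summable_prod_of_nonneg fun p => norm_nonneg _).2 ⟨fun n => ?_, ?_⟩)
    · simp_rw [hnorm]
      exact (summable_abs_exponentCoeff hα hμ hlam hu n).1.mul_left _
    · simp_rw [hnorm, tsum_mul_left]
      refine Summable.of_nonneg_of_le (fun n => mul_nonneg (he n) (tsum_nonneg fun k =>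
        abs_nonneg _)) (fun n => ?_) (hes _ (exponentBound_nonneg (α := α) hμ hlam hu))
      rw [mul_comm]
      exact mul_le_mul_of_nonneg_right (summable_abs_exponentCoeff hα hμ hlam hu n).2 (he n)
  have h1 : HasSum (fun n => (-1) ^ n * ((lam * (1 - u) + μ) ^ α - μ ^ α) ^ n * e n) (∑' p, F p) :=
    hsum.hasSum.prod_fiberwise fun n => by
      have := (hasSum_exponentCoeff (α := α) hμ hlam hu n).mul_left ((-1) ^ n * e n)
      convert! this using 1
      ring
  rw [hx.unique h1]
  have h2 : HasSum (F ∘ Prod.swap) (∑' p, F p) := (Equiv.prodComm ℕ ℕ).hasSum_iff.2 hsum.hasSum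
  have h3 := h2.prod_fiberwise fun k => (h2.summable.prod_factor k).hasSum
  refine h3.congr_fun fun k => ?_
  rw [← tsum_mul_right]
  refine tsum_congr fun n => ?_
  simp only [hF, Function.comp_apply, Prod.swap_prod_mk]
  ring

theorem stateTerm_eq (hμ : 0 ≤ μ) (hlam : 0 < lam) (h : μ < lam ∨ α = 1) (β ν t : ℝ)
    (k m r : ℕ) : stateTerm α μ β ν lam t k m r = (-1) ^ k * ((-1) ^ r * ((t ^ β) ^ r *
      prabhakar β (β * r + m + 1) r (t ^ β * ν ^ β)) * exponentCoeff α μ lam r k) := by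
  have e : ∑ h ∈ Finset.range (r + 1), (r.choose h : ℝ) * (-(μ ^ α)) ^ (r - h) *
      ∑' l : ℕ, binomTerm α μ lam k h l = (-1) ^ k * exponentCoeff α μ lam r k := by
    rw [exponentCoeff, ← mul_assoc, ← mul_pow, neg_one_mul, neg_neg, one_pow, one_mul]
    refine Finset.sum_congr rfl fun n _ => ?_
    rw [(hasSum_binomTerm hμ hlam h k n).tsum_eq]
  rw [stateTerm, e, neg_pow (t ^ β)]
  ring

end Coefficients

end Expansion

end TemperedPoisson

/-! ### Assembly of the state probabilities. -/

/-- `N` is a Poisson process of rate `lam`, `S` a tempered `α`-stable subordinator with parameter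
`μ`, and `D` a tempered `β`-stable subordinator with parameter `ν`, the three being mutually
independent. The state probabilities of `N (S (Y t))`, where `Y` is the inverse of `D`, are given
by the iterated series, all of whose constituent series converge. -/
theorem proposition5p4 {Ω : Type*} [MeasurableSpace Ω] (P : Measure Ω) [IsProbabilityMeasure P]
    (α β μ ν : ℝ) (lam : ℝ≥0)
    (hα : 0 < α) (hα1 : α ≤ 1) (hβ : 0 < β) (hβ1 : β < 1) (hμ : 0 ≤ μ) (hν : 0 ≤ ν)
    (hlam : 0 < lam) (hμlam : μ < lam ∨ α = 1)
    (N : ℝ≥0 → Ω → ℕ) (S D : ℝ≥0 → Ω → ℝ≥0)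
    (hN : IsPoissonProcess lam N P)
    (hS : IsTemperedStableSubordinator α μ S P)
    (hD : IsTemperedStableSubordinator β ν D P)
    (hSD : IndepFun (fun ω t => S t ω) (fun ω t => D t ω) P)
    (hNSD : IndepFun (fun ω t => N t ω) (fun ω => (fun t => S t ω, fun t => D t ω)) P)
    (k : ℕ) (t : ℝ≥0) :
    (∀ h : ℕ, Summable (binomTerm α μ lam k h)) ∧
    (∀ m r : ℕ, Summable (prabhakarTerm β (β * r + m + 1) r ((t : ℝ) ^ β * ν ^ β))) ∧
    (∀ m : ℕ, Summable (stateTerm α μ β ν lam t k m)) ∧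
    Summable (fun m : ℕ => (t : ℝ) ^ m * ν ^ m * ∑' r : ℕ, stateTerm α μ β ν lam t k m r) ∧
    P.real {ω | N (S (inverseProcess D t ω) ω) ω = k} =
      (-1) ^ k * Real.exp (-((t : ℝ) * ν)) *
        ∑' m : ℕ, (t : ℝ) ^ m * ν ^ m * ∑' r : ℕ, stateTerm α μ β ν lam t k m r := by
  set Y : Ω → ℝ≥0 := fun ω => firstPassage t fun r => D r ω
  have hY : IsFirstPassage D t Y P := hD.isFirstPassage hβ hν t
  have hlam' : (0 : ℝ) < lam := hlam
  set e : ℕ → ℝ := fun n => ∫ ω, ((Y ω : ℝ) ^ n / n !) ∂P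
  have he : ∀ n, 0 ≤ e n := fun n => IsFirstPassage.integral_pow_nonneg n
  have hes : ∀ K : ℝ, 0 ≤ K → Summable fun n => K ^ n * e n := fun K hK =>
    hY.summable_pow_mul_integral_pow hD hβ hν hK
  set A : ℕ → ℝ := fun r => exponentCoeff α μ lam r k
  have hprob : P.real {ω | N (S (inverseProcess D t ω) ω) ω = k} =
      ∑' n, (-1) ^ n * e n * A n :=
    congrFun (coeff_eq_of_hasSum_pow
      (a := fun k => P.real {ω | N (S (inverseProcess D t ω) ω) ω = k})
      (fun u hu => hasSum_stateProbability hμ hN hS hD hSD hNSD t hu)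
      fun u hu => hasSum_tsum_exponentCoeff hα hμ hlam' he hes hu
        (hY.hasSum_integral_exp hD hβ hν _)) k
  have hterm := fun m r => stateTerm_eq (α := α) hμ hlam' hμlam β ν t k m r
  have hq0 : ∀ r m, 0 ≤ momentTerm β ν t r m := IsFirstPassage.momentTerm_nonneg hβ hν
  have hq := hY.hasSum_momentTerm hD hβ hν
  have heA : Summable fun r => e r * |A r| :=
    summable_mul_abs_exponentCoeff hα hμ hlam' he hes k
  -- The double array behind both orders of summation: summing over m first yields the moments e_r,
  -- summing over r first yields the stated series.
  set G : ℕ × ℕ → ℝ := fun p => (-1) ^ p.2 * momentTerm β ν t p.2 p.1 * A p.2 with hG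
  have hGnorm : ∀ m r, ‖G (m, r)‖ = momentTerm β ν t r m * |A r| := fun m r => by
    simp only [hG, norm_mul, norm_pow, norm_neg, norm_one, one_pow, one_mul, Real.norm_eq_abs,
      abs_of_nonneg (hq0 r m)]
  have hGs : Summable (G ∘ Prod.swap) := by
    refine Summable.of_norm ((summable_prod_of_nonneg fun p => norm_nonneg _).2 ⟨fun r => ?_, ?_⟩)
    · simp only [Function.comp_apply, Prod.swap_prod_mk, hGnorm]
      exact (hq r).summable.mul_right _
    · simp only [Function.comp_apply, Prod.swap_prod_mk, hGnorm, tsum_mul_right, (hq _).tsum_eq]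
      exact heA
  have hGs' : Summable G := (Equiv.prodComm ℕ ℕ).summable_iff.1 hGs
  have hscale : ∀ m r, (t : ℝ) ^ m * ν ^ m * stateTerm α μ β ν lam t k m r =
      Real.exp ((t : ℝ) * ν) * (-1) ^ k * G (m, r) := fun m r => by
    have : Real.exp ((t : ℝ) * ν) * Real.exp (-((t : ℝ) * ν)) = 1 := by
      rw [← Real.exp_add]; simp
    simp only [hterm, hG, momentTerm]
    linear_combination (-((-1) ^ k * (-1) ^ r * A r * ((t : ℝ) ^ m * ν ^ m * ((t : ℝ) ^ β) ^ r) *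
      prabhakar β (β * r + m + 1) r ((t : ℝ) ^ β * ν ^ β))) * this
  have hinner : ∀ m, (t : ℝ) ^ m * ν ^ m * ∑' r : ℕ, stateTerm α μ β ν lam t k m r =
      Real.exp ((t : ℝ) * ν) * (-1) ^ k * ∑' r, G (m, r) := fun m => by
    rw [← tsum_mul_left, ← tsum_mul_left]
    exact tsum_congr (hscale m)
  refine ⟨fun h => (hasSum_binomTerm hμ hlam' hμlam k h).summable,
    hY.summable_prabhakarTerm hD hβ hν, fun m => ?_, ?_, ?_⟩
  -- Summability of G would not suffice here, since the factor t^m ν^m may be 0. Instead the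
  -- Prabhakar function is bounded by its value at m = 0, and the moment term with m = 0 by e_r.
  · refine Summable.of_norm_bounded (heA.mul_left (Real.exp ((t : ℝ) * ν))) fun r => ?_
    have h1 : momentTerm β ν t r 0 ≤ e r := (hq r).summable.le_tsum 0 (fun m _ => hq0 r m)
      |>.trans_eq (hq r).tsum_eq
    have h2 : ((t : ℝ) ^ β) ^ r * prabhakar β (β * r + (0 : ℕ) + 1) r ((t : ℝ) ^ β * ν ^ β) =
        Real.exp ((t : ℝ) * ν) * momentTerm β ν t r 0 := by
      rw [momentTerm, ← mul_assoc, ← mul_assoc, ← Real.exp_add]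
      simp
    rw [hterm]
    simp only [norm_mul, norm_pow, norm_neg, norm_one, one_pow, one_mul, Real.norm_eq_abs]
    rw [abs_of_nonneg (IsFirstPassage.prabhakar_nonneg hβ hν m r),
      abs_of_nonneg (by positivity : 0 ≤ (t : ℝ) ^ β), ← mul_assoc]
    refine mul_le_mul_of_nonneg_right ?_ (abs_nonneg _)
    calc _ ≤ ((t : ℝ) ^ β) ^ r *
          prabhakar β (β * r + (0 : ℕ) + 1) r ((t : ℝ) ^ β * ν ^ β) :=
        mul_le_mul_of_nonneg_left (hY.prabhakar_le hD hβ hν m r) (by positivity)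
      _ ≤ _ := by rw [h2]; gcongr
  · simp_rw [hinner]
    exact hGs'.prod.mul_left _
  · simp_rw [hinner]
    have hswap : ∑' m, ∑' r, G (m, r) = ∑' n, (-1) ^ n * e n * A n := by
      rw [← hGs'.tsum_prod, ← (Equiv.prodComm ℕ ℕ).tsum_eq G]
      refine hGs.tsum_prod.trans (tsum_congr fun r => ?_)
      simp only [Function.comp_apply, Prod.swap_prod_mk, hG]
      rw [tsum_mul_right, tsum_mul_left, (hq r).tsum_eq]
    rw [tsum_mul_left, hswap, ← hprob]
    have h1 : Real.exp (-((t : ℝ) * ν)) * Real.exp ((t : ℝ) * ν) = 1 := by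
      rw [← Real.exp_add]; simp
    have h2 : ((-1 : ℝ) ^ k) * (-1) ^ k = 1 := by rw [← mul_pow]; simp
    linear_combination (-(P.real {ω | N (S (inverseProcess D t ω) ω) ω = k}) * (-1) ^ k *
      (-1) ^ k) * h1 - P.real {ω | N (S (inverseProcess D t ω) ω) ω = k} * h2
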